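/- Let $\mathbb H$ be the quaternions. For $s\in\{-1,1\}$ let $\mathbb A_s$ be $\mathbb H\oplus\mathbb H$ with the multiplication $$(q_1,q_2)(p_1,p_2)=(q_1p_1+s\,\bar p_2q_2,\;p_2q_1+q_2\bar p_1),$$ conjugation $\overline{(q_1,q_2)}=(\bar q_1,-q_2)$, inner product $\langle a,b\rangle=\mathrm{Re}(a\bar b)$ and $|a|^2=\langle a,a\rangle$. So $\mathbb O=\mathbb A_{-1}$ are the octonions and $\mathbb O'=\mathbb A_{1}$ the para-octonions (there $|\cdot|^2$ has signature $(4,4)$). **The planes.** For $i=1,2,3$ let $U_i\subset\mathbb A_s^3$ be the set of triples $(a_1,a_2,a_3)$ with $a_i=1$ and $|a_1|^2+|a_2|^2+|a_3|^2>0$. On $U_1\cup U_2\cup U_3$ write $a\sim b$ if there is $\lambda\in\mathbb A_s$ with $|\lambda|^2>0$ and $a_j=b_j\lambda$ for all $j$; this is an equivalence relation, and the quotient is $\mathbb OP^2$ for $s=-1$ (where the inequalities only say $\lambda\ne0$) and $\mathbb O'P^2$ for $s=1$. It is a smooth $16$-manifold with the three charts $[1,u,v]\mapsto(u,v)$, $[u,1,v]\mapsto(u,v)$,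 $[u,v,1]\mapsto(u,v)$, each with image $\{1+|u|^2+|v|^2>0\}\subset\mathbb A_s^2$. Its metric is given in each of the three charts by $$ds^2=\frac{|du|^2(1+|v|^2)+|dv|^2(1+|u|^2)-2\,\mathrm{Re}\big[(u\bar v)(dv\,d\bar u)\big]}{(1+|u|^2+|v|^2)^2}.$$ The octonionic hyperbolic plane is $\mathbb OH^2=\{(u,v)\in\mathbb O^2:|u|^2+|v|^2<1\}$ with the metric $$ds^2=\frac{|du|^2(1-|v|^2)+|dv|^2(1-|u|^2)+2\,\mathrm{Re}\big[(u\bar v)(dv\,d\bar u)\big]}{(1-|u|^2-|v|^2)^2}.$$ **Special Osserman manifolds.** Let $(M,g)$ be a semi-Riemannian manifold, with curvature $R(x,y)=\nabla_y\nabla_x-\nabla_x\nabla_y+\nabla_{[x,y]}$ of the Levi-Civita connection, Jacobi operators $\mathcal J_v(x)=R(v,x)v$ on $T_PM$, and $\varepsilon_v=g(v,v)$; a vector $v$ is unit if $\varepsilon_v=\pm1$. $(M,g)$ is a special Osserman manifold with constants $\lambda\neq\mu$, both non-zero, if for all $P\in M$: * (I) for every unit $v\in T_PM$, $\mathcal J_v$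 maps $v^\perp$ to itself, and $\mathcal J_v:v^\perp\to v^\perp$ is diagonalizable with exactly two non-zero eigenvalues, $\varepsilon_v\lambda$ and $\varepsilon_v\mu$; * (II) if $v,w\in T_PM$ are unit and $w\in E_\lambda(v):=\mathrm{span}\{v\}\oplus\ker(\mathcal J_v-\varepsilon_v\lambda\,\mathrm{Id})$, then $E_\lambda(v)=E_\lambda(w)$; * (III) if $v\in T_PM$ is unit, $w\in T_PM$ and $w\in\ker(\mathcal J_v-\varepsilon_v\mu\,\mathrm{Id})$, then $v\in\ker(\mathcal J_w-\varepsilon_w\mu\,\mathrm{Id})$. **Theorem.** The formulas for $ds^2$ above define semi-Riemannian metrics on $\mathbb OP^2$, $\mathbb O'P^2$ and $\mathbb OH^2$ (in particular, on the first two the expressions in the three charts agree on overlaps). With these metrics, $\mathbb OP^2$ and $\mathbb O'P^2$ are special Osserman manifolds with constants $\lambda=4$, $\mu=1$, and $\mathbb OH^2$ is a special Osserman manifold with constants $\lambda=-4$, $\mu=-1$. In all three cases, at every point and for every unit $v$, the eigenvalue $\varepsilon_v\lambda$ of $\mathcal J_v:v^\perp\to v^\perp$ has multiplicity $7$ and $\varepsilon_v\mu$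 has multiplicity $8$. -/

import Mathlib

open scoped Quaternion Manifold ContDiff

set_option maxSynthPendingDepth 3

noncomputable section

/-! ### Octonions and para-octonions -/

/-- The algebra `ℍ ⊕ ℍ` with multiplication
`(q₁, q₂) * (p₁, p₂) = (q₁ p₁ + s p̄₂ q₂, p₂ q₁ + q₂ p̄₁)`. The normed space structure is that of
`ℍ × ℍ`; it only serves to give the 8-dimensional real vector space its topology. -/
def CayleyAlgebra (_s : ℝ) : Type := ℍ[ℝ] × ℍ[ℝ]

/-- The octonions `𝕆`. -/
abbrev Octonion : Type := CayleyAlgebra (-1)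

/-- The para-octonions (split octonions) `𝕆'`. -/
abbrev ParaOctonion : Type := CayleyAlgebra 1

namespace CayleyAlgebra

variable {s : ℝ}

instance : NormedAddCommGroup (CayleyAlgebra s) :=
  inferInstanceAs (NormedAddCommGroup (ℍ[ℝ] × ℍ[ℝ]))

instance : NormedSpace ℝ (CayleyAlgebra s) :=
  inferInstanceAs (NormedSpace ℝ (ℍ[ℝ] × ℍ[ℝ]))

instance : FiniteDimensional ℝ (CayleyAlgebra s) :=
  inferInstanceAs (FiniteDimensional ℝ (ℍ[ℝ] × ℍ[ℝ]))

instance : Mul (CayleyAlgebra s) :=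
  ⟨fun x y => (x.1 * y.1 + s • (star y.2 * x.2), y.2 * x.1 + x.2 * star y.1)⟩

instance : One (CayleyAlgebra s) := ⟨((1 : ℍ[ℝ]), (0 : ℍ[ℝ]))⟩

/-- Conjugation. -/
instance : Star (CayleyAlgebra s) := ⟨fun x => (star x.1, -x.2)⟩

/-- Real part. -/
def re (x : CayleyAlgebra s) : ℝ := x.1.re

/-- The inner product `⟨a, b⟩ = Re (a b̄)`. -/
def ip (a b : CayleyAlgebra s) : ℝ := re (a * star b)

/-- `|a|² = ⟨a, a⟩`; it may be negative or zero for a para-octonion `a ≠ 0`. -/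
def normSq (a : CayleyAlgebra s) : ℝ := ip a a

instance : Inv (CayleyAlgebra s) := ⟨fun x => (normSq x)⁻¹ • star x⟩

theorem ext' {x y : CayleyAlgebra s} (h₁ : x.1 = y.1) (h₂ : x.2 = y.2) : x = y :=
  Prod.ext h₁ h₂

@[simp] theorem add_fst (x y : CayleyAlgebra s) : (x + y).1 = x.1 + y.1 := rfl
@[simp] theorem add_snd (x y : CayleyAlgebra s) : (x + y).2 = x.2 + y.2 := rfl
@[simp] theorem zero_fst : (0 : CayleyAlgebra s).1 = 0 := rfl
@[simp] theorem zero_snd : (0 : CayleyAlgebra s).2 = 0 := rfl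
@[simp] theorem smul_fst (r : ℝ) (x : CayleyAlgebra s) : (r • x).1 = r • x.1 := rfl
@[simp] theorem smul_snd (r : ℝ) (x : CayleyAlgebra s) : (r • x).2 = r • x.2 := rfl
@[simp] theorem one_fst : (1 : CayleyAlgebra s).1 = 1 := rfl
@[simp] theorem one_snd : (1 : CayleyAlgebra s).2 = 0 := rfl
@[simp] theorem star_fst (x : CayleyAlgebra s) : (star x).1 = star x.1 := rfl
@[simp] theorem star_snd (x : CayleyAlgebra s) : (star x).2 = -x.2 := rfl
@[simp] theorem mul_fst (x y : CayleyAlgebra s) :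
    (x * y).1 = x.1 * y.1 + s • (star y.2 * x.2) := rfl
@[simp] theorem mul_snd (x y : CayleyAlgebra s) :
    (x * y).2 = y.2 * x.1 + x.2 * star y.1 := rfl

instance : NonAssocRing (CayleyAlgebra s) :=
  { (inferInstance : AddCommGroup (CayleyAlgebra s)) with
    mul := (· * ·)
    one := 1
    left_distrib := fun a b c => ext'
      (by simp [mul_add, add_mul]; abel) (by simp [mul_add, add_mul]; abel)
    right_distrib := fun a b c => ext'
      (by simp [mul_add, add_mul]; abel) (by simp [mul_add, add_mul]; abel)
    zero_mul := fun a => ext' (by simp) (by simp)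
    mul_zero := fun a => ext' (by simp) (by simp)
    one_mul := fun a => ext' (by simp) (by simp)
    mul_one := fun a => ext' (by simp) (by simp) }

instance : IsScalarTower ℝ (CayleyAlgebra s) (CayleyAlgebra s) :=
  ⟨fun r x y => ext' (by simp [smul_smul, mul_comm]) (by simp)⟩

instance : SMulCommClass ℝ (CayleyAlgebra s) (CayleyAlgebra s) :=
  ⟨fun r x y => ext' (by simp [smul_smul, mul_comm]) (by simp)⟩

theorem star_add' (x y : CayleyAlgebra s) : star (x + y) = star x + star y :=
  ext' (by simp) (by simp [add_comm])

theorem star_smul' (r : ℝ) (x : CayleyAlgebra s) : star (r • x) = r • star x :=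
  ext' (by simp) (by simp)

theorem re_add (x y : CayleyAlgebra s) : re (x + y) = re x + re y := by simp [re]

theorem re_smul (r : ℝ) (x : CayleyAlgebra s) : re (r • x) = r * re x := by simp [re]

theorem normSq_eq (x : CayleyAlgebra s) :
    normSq x = Quaternion.normSq x.1 - s * Quaternion.normSq x.2 := by
  simp only [normSq, ip, re, mul_fst, star_fst, star_snd, Quaternion.normSq_def']
  simp
  ring

theorem star_mul' (x y : CayleyAlgebra s) : star (x * y) = star y * star x :=
  ext' (by simp) (by simp [add_comm])

theorem star_mul_mul (x y : CayleyAlgebra s) : star x * (x * y) = normSq x • y := by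
  rw [normSq_eq]
  apply ext' <;> ext <;> simp [Quaternion.normSq_def'] <;> ring

theorem mul_mul_star (x y : CayleyAlgebra s) : y * x * star x = normSq x • y := by
  rw [normSq_eq]
  apply ext' <;> ext <;> simp [Quaternion.normSq_def'] <;> ring

theorem normSq_star (x : CayleyAlgebra s) : normSq (star x) = normSq x := by
  simp [normSq_eq]

theorem star_star' (x : CayleyAlgebra s) : star (star x) = x :=
  ext' (by simp) (by simp)

theorem normSq_mul (x y : CayleyAlgebra s) : normSq (x * y) = normSq x * normSq y := by
  simp only [normSq_eq, Quaternion.normSq_def']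
  simp
  ring

theorem normSq_smul (r : ℝ) (x : CayleyAlgebra s) : normSq (r • x) = r ^ 2 * normSq x := by
  simp only [normSq_eq, Quaternion.normSq_def']
  simp
  ring

theorem normSq_one : normSq (1 : CayleyAlgebra s) = 1 := by simp [normSq_eq]

theorem inv_def (x : CayleyAlgebra s) : x⁻¹ = (normSq x)⁻¹ • star x := rfl

theorem inv_mul_mul {x : CayleyAlgebra s} (hx : 0 < normSq x) (y : CayleyAlgebra s) :
    x⁻¹ * (x * y) = y := by
  rw [inv_def, smul_mul_assoc, star_mul_mul, smul_smul, inv_mul_cancel₀ hx.ne', one_smul]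

theorem mul_mul_inv {x : CayleyAlgebra s} (hx : 0 < normSq x) (y : CayleyAlgebra s) :
    y * x * x⁻¹ = y := by
  rw [inv_def, mul_smul_comm, mul_mul_star, smul_smul, inv_mul_cancel₀ hx.ne', one_smul]

theorem normSq_inv (x : CayleyAlgebra s) : normSq x⁻¹ = (normSq x)⁻¹ := by
  rw [inv_def, normSq_smul, normSq_star]
  rcases eq_or_ne (normSq x) 0 with h | h
  · simp [h]
  · field_simp

theorem inv_inv' {x : CayleyAlgebra s} (hx : 0 < normSq x) : (x⁻¹)⁻¹ = x := by
  rw [inv_def x⁻¹, normSq_inv, inv_inv, inv_def, star_smul', star_star', smul_smul,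
    mul_inv_cancel₀ hx.ne', one_smul]

theorem mul_inv_rev' (x y : CayleyAlgebra s) : (x * y)⁻¹ = y⁻¹ * x⁻¹ := by
  rw [inv_def, inv_def, inv_def, normSq_mul, star_mul', smul_mul_assoc, mul_smul_comm, smul_smul,
    mul_inv, mul_comm (normSq x)⁻¹]

theorem inv_one' : (1 : CayleyAlgebra s)⁻¹ = 1 := by
  rw [inv_def, normSq_one]
  exact ext' (by simp) (by simp)

/-- On the octonions `|a|²` is positive for every `a ≠ 0`. -/
theorem octonion_normSq_pos_iff (a : Octonion) : 0 < normSq a ↔ a ≠ 0 := by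
  rw [normSq_eq]
  have h₁ : 0 ≤ Quaternion.normSq a.1 := Quaternion.normSq_nonneg
  have h₂ : 0 ≤ Quaternion.normSq a.2 := Quaternion.normSq_nonneg
  constructor
  · rintro h rfl
    simp at h
  · intro h
    by_contra hn
    refine h (ext' ?_ ?_)
    · exact Quaternion.normSq_eq_zero.1 (by linarith)
    · exact Quaternion.normSq_eq_zero.1 (by linarith)

theorem continuous_normSq : Continuous (normSq : CayleyAlgebra s → ℝ) := by
  have : (normSq : CayleyAlgebra s → ℝ) = fun x : ℍ[ℝ] × ℍ[ℝ] =>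
      Quaternion.normSq x.1 - s * Quaternion.normSq x.2 := funext normSq_eq
  rw [this]
  exact (Quaternion.continuous_normSq.comp continuous_fst).sub
    (continuous_const.mul (Quaternion.continuous_normSq.comp continuous_snd))

end CayleyAlgebra

/-! ### Curvature of a semi-Riemannian metric -/

section Geometry

variable {E : Type*} [NormedAddCommGroup E] [NormedSpace ℝ E]

/-- The Christoffel symbols of first kind of a metric `G` on (an open subset of) `E`:
`K x u v w = (∂_u G(v, w) + ∂_v G(u, w) - ∂_w G(u, v)) / 2` at `x`. -/
def christoffelLower (G : E → E →L[ℝ] E →L[ℝ] ℝ) (x : E) : E →L[ℝ] E →L[ℝ] E →L[ℝ] ℝ :=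
  (1 / 2 : ℝ) • (fderiv ℝ G x + (fderiv ℝ G x).flip -
    ((ContinuousLinearMap.flipₗᵢ ℝ E E ℝ).toContinuousLinearEquiv :
      (E →L[ℝ] E →L[ℝ] ℝ) →L[ℝ] (E →L[ℝ] E →L[ℝ] ℝ)).comp (fderiv ℝ G x).flip)

theorem christoffelLower_apply (G : E → E →L[ℝ] E →L[ℝ] ℝ) (x u v w : E) :
    christoffelLower G x u v w =
      (fderiv ℝ G x u v w + fderiv ℝ G x v u w - fderiv ℝ G x w u v) / 2 := by
  simp [christoffelLower]
  ring

/-- The Christoffel symbols `Γ x u v` of second kind: the index of `christoffelLower` is raised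
with the inverse of `G x : E → E*`, so that `∇_u v = ∂_u v + Γ(u, v)` is the Levi-Civita
connection of `G`. -/
def christoffel (G : E → E →L[ℝ] E →L[ℝ] ℝ) (x : E) : E →L[ℝ] E →L[ℝ] E :=
  (ContinuousLinearMap.compL ℝ E (E →L[ℝ] ℝ) E (G x).inverse).comp (christoffelLower G x)

theorem christoffel_apply (G : E → E →L[ℝ] E →L[ℝ] ℝ) (x u v : E) :
    christoffel G x u v = (G x).inverse (christoffelLower G x u v) := rfl

/-- The curvature `R(u, v)w` at `x` of the metric `G`, with the sign convention
`R(u, v) = ∇_v ∇_u - ∇_u ∇_v + ∇_[u, v]`. -/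
def curvature (G : E → E →L[ℝ] E →L[ℝ] ℝ) (x u v w : E) : E :=
  fderiv ℝ (christoffel G) x v u w - fderiv ℝ (christoffel G) x u v w
    + christoffel G x v (christoffel G x u w) - christoffel G x u (christoffel G x v w)

/-- The Jacobi operator `J_v(y) = R(v, y)v` at `x` of the metric `G`. -/
def jacobiLocal (G : E → E →L[ℝ] E →L[ℝ] ℝ) (x v : E) : E →ₗ[ℝ] E where
  toFun y := curvature G x v y v
  map_add' y z := by
    simp only [curvature, map_add, add_apply]
    abel
  map_smul' r y := by
    simp only [curvature, map_smul, smul_apply, RingHom.id_apply]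
    module

variable {M : Type*} [TopologicalSpace M] [ChartedSpace E M]

/-- The expression in the chart `e` of a field `g` of bilinear forms on tangent spaces. -/
def localMetric
    (g : ∀ p : M, TangentSpace 𝓘(ℝ, E) p →L[ℝ] TangentSpace 𝓘(ℝ, E) p →L[ℝ] ℝ)
    (e : OpenPartialHomeomorph M E) (x : E) : E →L[ℝ] E →L[ℝ] ℝ :=
  ContinuousLinearMap.bilinearComp (E := E) (F := E) (g (e.symm x) : E →L[ℝ] E →L[ℝ] ℝ)
    (mfderiv 𝓘(ℝ, E) 𝓘(ℝ, E) e.symm x) (mfderiv 𝓘(ℝ, E) 𝓘(ℝ, E) e.symm x)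

/-- `g` is a semi-Riemannian metric: a smooth field of non-degenerate symmetric bilinear forms on
the tangent spaces. -/
structure IsSemiRiemannian
    (g : ∀ p : M, TangentSpace 𝓘(ℝ, E) p →L[ℝ] TangentSpace 𝓘(ℝ, E) p →L[ℝ] ℝ) : Prop where
  symm : ∀ p v w, g p v w = g p w v
  nondegenerate : ∀ p v, (∀ w, g p v w = 0) → v = 0
  smooth : ∀ e ∈ atlas E M, ContDiffOn ℝ ∞ (localMetric g e) e.target

/-- The Jacobi operator `J_v(x) = R(v, x)v` at `p`. It is computed in the preferred chart at `p`,
whose differential at `p` is the identification of `TangentSpace 𝓘(ℝ, E) p` with `E`. -/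
def jacobi
    (g : ∀ p : M, TangentSpace 𝓘(ℝ, E) p →L[ℝ] TangentSpace 𝓘(ℝ, E) p →L[ℝ] ℝ)
    (p : M) (v : TangentSpace 𝓘(ℝ, E) p) : Module.End ℝ (TangentSpace 𝓘(ℝ, E) p) :=
  jacobiLocal (E := E) (localMetric g (chartAt E p)) (chartAt E p p) v

/-- The orthogonal complement `v^⊥`. -/
def perp
    (g : ∀ p : M, TangentSpace 𝓘(ℝ, E) p →L[ℝ] TangentSpace 𝓘(ℝ, E) p →L[ℝ] ℝ)
    (p : M) (v : TangentSpace 𝓘(ℝ, E) p) : Submodule ℝ (TangentSpace 𝓘(ℝ, E) p) :=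
  LinearMap.ker (g p v : TangentSpace 𝓘(ℝ, E) p →ₗ[ℝ] ℝ)

/-- Unit vectors, spacelike or timelike: `g(v, v) = 1` or `g(v, v) = -1`. -/
def IsUnitVector
    (g : ∀ p : M, TangentSpace 𝓘(ℝ, E) p →L[ℝ] TangentSpace 𝓘(ℝ, E) p →L[ℝ] ℝ)
    (p : M) (v : TangentSpace 𝓘(ℝ, E) p) : Prop :=
  g p v v = 1 ∨ g p v v = -1

/-- `ker (J_v - ε_v c Id)`, where `ε_v = g(v, v)`. -/
def jacobiEigenspace
    (g : ∀ p : M, TangentSpace 𝓘(ℝ, E) p →L[ℝ] TangentSpace 𝓘(ℝ, E) p →L[ℝ] ℝ)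
    (c : ℝ) (p : M) (v : TangentSpace 𝓘(ℝ, E) p) : Submodule ℝ (TangentSpace 𝓘(ℝ, E) p) :=
  (jacobi g p v).eigenspace (g p v v * c)

/-- `E_c(v) = span {v} ⊕ ker (J_v - ε_v c Id)`. -/
def extendedEigenspace
    (g : ∀ p : M, TangentSpace 𝓘(ℝ, E) p →L[ℝ] TangentSpace 𝓘(ℝ, E) p →L[ℝ] ℝ)
    (c : ℝ) (p : M) (v : TangentSpace 𝓘(ℝ, E) p) : Submodule ℝ (TangentSpace 𝓘(ℝ, E) p) :=
  Submodule.span ℝ {v} ⊔ jacobiEigenspace g c p v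

/-- `(M, g)` is a special Osserman manifold, and the constants in its defining conditions are
`lam` and `mu`. -/
structure IsSpecialOssermanWith
    (g : ∀ p : M, TangentSpace 𝓘(ℝ, E) p →L[ℝ] TangentSpace 𝓘(ℝ, E) p →L[ℝ] ℝ)
    (lam mu : ℝ) : Prop where
  isSemiRiemannian : IsSemiRiemannian g
  lam_ne_zero : lam ≠ 0
  mu_ne_zero : mu ≠ 0
  lam_ne_mu : lam ≠ mu
  /-- Condition (I): `J_v` maps `v^⊥` to itself, this restriction is diagonalizable, and its
  non-zero eigenvalues are exactly `ε_v lam` and `ε_v mu`. -/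
  condition_one : ∀ p v, IsUnitVector g p v →
    ∃ h : ∀ x ∈ perp g p v, jacobi g p v x ∈ perp g p v,
      (⨆ c : ℝ, Module.End.eigenspace ((jacobi g p v).restrict h) c) = ⊤ ∧
      ∀ c : ℝ, c ≠ 0 → (Module.End.HasEigenvalue ((jacobi g p v).restrict h) c ↔
        c = g p v v * lam ∨ c = g p v v * mu)
  /-- Condition (II). -/
  condition_two : ∀ p v w, IsUnitVector g p v → IsUnitVector g p w →
    w ∈ extendedEigenspace g lam p v → extendedEigenspace g lam p v = extendedEigenspace g lam p w
  /-- Condition (III); `w` is not required to be a unit vector. -/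
  condition_three : ∀ p v w, IsUnitVector g p v →
    w ∈ jacobiEigenspace g mu p v → v ∈ jacobiEigenspace g mu p w

/-- For every unit `v`, the eigenvalue `ε_v c` of `J_v : v^⊥ → v^⊥` has multiplicity `k`. -/
def HasMultiplicity
    (g : ∀ p : M, TangentSpace 𝓘(ℝ, E) p →L[ℝ] TangentSpace 𝓘(ℝ, E) p →L[ℝ] ℝ)
    (c : ℝ) (k : ℕ) : Prop :=
  ∀ p v, IsUnitVector g p v → Module.finrank ℝ ↥(jacobiEigenspace g c p v ⊓ perp g p v) = k

end Geometry

/-! ### The planes -/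

namespace CayleyAlgebra

variable {s : ℝ}

theorem contDiff_mul : ContDiff ℝ ∞ fun x : CayleyAlgebra s × CayleyAlgebra s => x.1 * x.2 :=
  (LinearMap.mul ℝ (CayleyAlgebra s)).toContinuousBilinearMap.isBoundedBilinearMap.contDiff

instance : ContinuousMul (CayleyAlgebra s) := ⟨contDiff_mul.continuous⟩

theorem contDiff_star : ContDiff ℝ ∞ (star : CayleyAlgebra s → CayleyAlgebra s) :=
  (LinearMap.toContinuousLinearMap
    ({ toFun := star, map_add' := star_add', map_smul' := star_smul' } :
      CayleyAlgebra s →ₗ[ℝ] CayleyAlgebra s)).contDiff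

theorem contDiff_re : ContDiff ℝ ∞ (re : CayleyAlgebra s → ℝ) :=
  (LinearMap.toContinuousLinearMap
    ({ toFun := re, map_add' := re_add, map_smul' := re_smul } : CayleyAlgebra s →ₗ[ℝ] ℝ)).contDiff

theorem contDiff_normSq : ContDiff ℝ ∞ (normSq : CayleyAlgebra s → ℝ) :=
  contDiff_re.comp (contDiff_mul.comp (contDiff_id.prodMk contDiff_star))

end CayleyAlgebra

open CayleyAlgebra

/-- The set `U_i` of reduced homogeneous coordinates: the triples `a` with `a_i = 1` and
`|a₁|² + |a₂|² + |a₃|² > 0`. For octonions the second condition holds automatically. -/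
def reducedTriples (s : ℝ) (i : Fin 3) : Set (Fin 3 → CayleyAlgebra s) :=
  {a | a i = 1 ∧ 0 < ∑ j, normSq (a j)}

/-- `[a] ∼ [b]` if `a = b λ` for some `λ` with `|λ|² > 0`; for octonions this means `λ ≠ 0`. -/
def ProjRel {s : ℝ} (a b : Fin 3 → CayleyAlgebra s) : Prop :=
  ∃ l : CayleyAlgebra s, 0 < normSq l ∧ ∀ j, a j = b j * l

theorem projRel_iff {s : ℝ} {i : Fin 3} {a b : Fin 3 → CayleyAlgebra s} (ha : a i = 1) :
    ProjRel a b ↔ 0 < normSq (b i) ∧ ∀ j, a j = b j * (b i)⁻¹ := by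
  constructor
  · rintro ⟨l, hl, h⟩
    have hb : b i = l⁻¹ := by
      have := mul_mul_inv hl (b i)
      rw [← h i, ha, one_mul] at this
      exact this.symm
    refine ⟨by rw [hb, normSq_inv]; exact inv_pos.2 hl, fun j => ?_⟩
    rw [hb, inv_inv' hl, h j]
  · rintro ⟨hb, h⟩
    exact ⟨(b i)⁻¹, by rw [normSq_inv]; exact inv_pos.2 hb, h⟩

theorem projRel_symm {s : ℝ} {a b : Fin 3 → CayleyAlgebra s} (h : ProjRel a b) : ProjRel b a := by
  obtain ⟨l, hl, h⟩ := h
  exact ⟨l⁻¹, by rw [normSq_inv]; exact inv_pos.2 hl, fun j => by rw [h j, mul_mul_inv hl]⟩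

theorem projRel_trans {s : ℝ} {i j k : Fin 3} {a b c : Fin 3 → CayleyAlgebra s} (ha : a i = 1)
    (hb : b j = 1) (hc : c k = 1) (hab : ProjRel a b) (hbc : ProjRel b c) : ProjRel a c := by
  rw [projRel_iff ha] at hab ⊢
  rw [projRel_iff hb] at hbc
  obtain ⟨hbi, hab⟩ := hab
  obtain ⟨hcj, hbc⟩ := hbc
  have hci : 0 < normSq (c i) := by
    rw [hbc i, normSq_mul, normSq_inv] at hbi
    exact (pos_iff_pos_of_mul_pos hbi).2 (inv_pos.2 hcj)
  refine ⟨hci, fun m => ?_⟩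
  have key : a m = c m * (c j)⁻¹ * (c j * (c i)⁻¹) := by
    rw [hab m, hbc m, hbc i, mul_inv_rev', inv_inv' hcj]
  have e₁ : c j * (c j)⁻¹ = 1 := by simpa using mul_mul_inv hcj 1
  have e₂ : c i * (c i)⁻¹ = 1 := by simpa using mul_mul_inv hci 1
  have e₃ : ∀ x : CayleyAlgebra s, (c j)⁻¹ * (c j * x) = x := inv_mul_mul hcj
  have e₄ : ∀ x : CayleyAlgebra s, x * (c j)⁻¹ * c j = x := fun x => by
    have h := mul_mul_inv (x := (c j)⁻¹) (by rw [normSq_inv]; exact inv_pos.2 hcj) x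
    rwa [inv_inv' hcj] at h
  rw [key]
  by_cases hmj : m = j
  · subst hmj
    rw [e₁, one_mul]
  by_cases hmi : m = i
  · subst hmi
    have h := mul_mul_inv (x := c m * (c j)⁻¹)
      (by rw [normSq_mul, normSq_inv]; exact mul_pos hci (inv_pos.2 hcj)) 1
    rw [mul_inv_rev', inv_inv' hcj, one_mul] at h
    rw [h, e₂]
  by_cases hij : i = j
  · subst hij
    rw [e₂, mul_one]
  have hk : k = m ∨ k = j ∨ k = i := by omega
  rcases hk with rfl | rfl | rfl
  · rw [hc, one_mul, one_mul, e₃]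
  · rw [hc, inv_one', mul_one, one_mul]
  · rw [hc, inv_one', mul_one, mul_one, e₄]

/-- The equivalence relation `∼` on `𝒰 = U₁ ∪ U₂ ∪ U₃`. -/
def planeSetoid (s : ℝ) : Setoid ↥(⋃ i, reducedTriples s i) where
  r a b := ProjRel a.1 b.1
  iseqv :=
    { refl := fun a => ⟨1, by rw [normSq_one]; exact one_pos, fun j => by rw [mul_one]⟩
      symm := projRel_symm
      trans := fun {a b c} hab hbc => by
        obtain ⟨i, hi⟩ := Set.mem_iUnion.1 a.2
        obtain ⟨j, hj⟩ := Set.mem_iUnion.1 b.2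
        obtain ⟨k, hk⟩ := Set.mem_iUnion.1 c.2
        exact projRel_trans hi.1 hj.1 hk.1 hab hbc }

/-- The projective plane `𝒰 / ∼`. -/
def Plane (s : ℝ) : Type := Quotient (planeSetoid s)

/-- The class `[a₁, a₂, a₃]`. -/
def Plane.mk {s : ℝ} (a : ↥(⋃ i, reducedTriples s i)) : Plane s := Quotient.mk (planeSetoid s) a

theorem Plane.mk_eq_mk {s : ℝ} {a b : ↥(⋃ i, reducedTriples s i)} :
    Plane.mk a = Plane.mk b ↔ ProjRel a.1 b.1 :=
  Quotient.eq (r := planeSetoid s)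

/-- The octonionic projective plane `𝕆P²`. -/
abbrev OctonionicPlane : Type := Plane (-1)

/-- The para-octonionic projective plane `𝕆'P²`. -/
abbrev ParaOctonionicPlane : Type := Plane 1

/-- The common image `{(u, v) : 1 + |u|² + |v|² > 0}` of the three charts. -/
def coordDomain (s : ℝ) : Set (CayleyAlgebra s × CayleyAlgebra s) :=
  {x | 0 < 1 + normSq x.1 + normSq x.2}

/-- For octonions the charts are onto `𝕆²`. -/
theorem coordDomain_octonion : coordDomain (-1) = Set.univ := by
  refine Set.eq_univ_of_forall fun x => ?_
  have h : ∀ a : Octonion, 0 ≤ normSq a := fun a => by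
    rcases eq_or_ne a 0 with rfl | ha
    · simp [normSq_eq]
    · exact ((octonion_normSq_pos_iff a).2 ha).le
  have h₁ := h x.1
  have h₂ := h x.2
  simp only [coordDomain, Set.mem_ofPred_eq]
  linarith

/-- The triples `(1, u, v)`, `(u, 1, v)`, `(u, v, 1)`. -/
def triple {s : ℝ} (i : Fin 3) (x : CayleyAlgebra s × CayleyAlgebra s) : Fin 3 → CayleyAlgebra s :=
  match i with
  | 0 => ![1, x.1, x.2]
  | 1 => ![x.1, 1, x.2]
  | 2 => ![x.1, x.2, 1]

theorem triple_self {s : ℝ} (i : Fin 3) (x : CayleyAlgebra s × CayleyAlgebra s) :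
    triple i x i = 1 := by
  fin_cases i <;> rfl

theorem sum_normSq_triple {s : ℝ} (i : Fin 3) (x : CayleyAlgebra s × CayleyAlgebra s) :
    ∑ j, normSq (triple i x j) = 1 + normSq x.1 + normSq x.2 := by
  fin_cases i <;> simp [triple, Fin.sum_univ_three, normSq_one] <;> ring

theorem triple_mem {s : ℝ} (i : Fin 3) {x : CayleyAlgebra s × CayleyAlgebra s}
    (hx : x ∈ coordDomain s) : triple i x ∈ ⋃ i, reducedTriples s i :=
  Set.mem_iUnion.2 ⟨i, triple_self i x, by rw [sum_normSq_triple]; exact hx⟩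

theorem zero_mem_coordDomain {s : ℝ} : (0 : CayleyAlgebra s × CayleyAlgebra s) ∈ coordDomain s := by
  simp [coordDomain, normSq_eq]

open Classical in
/-- The inverse of the `i`-th chart: `(u, v)` is sent to the class of `(1, u, v)`, `(u, 1, v)` or
`(u, v, 1)`. The value outside of `coordDomain s` is irrelevant. -/
def ofCoord {s : ℝ} (i : Fin 3) (x : CayleyAlgebra s × CayleyAlgebra s) : Plane s :=
  if h : x ∈ coordDomain s then Plane.mk ⟨triple i x, triple_mem i h⟩
  else Plane.mk ⟨triple i 0, triple_mem i zero_mem_coordDomain⟩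

theorem ofCoord_eq_iff {s : ℝ} {i j : Fin 3} {x y : CayleyAlgebra s × CayleyAlgebra s}
    (hx : x ∈ coordDomain s) (hy : y ∈ coordDomain s) :
    ofCoord i x = ofCoord j y ↔ ProjRel (triple i x) (triple j y) := by
  rw [ofCoord, ofCoord, dif_pos hx, dif_pos hy, Plane.mk_eq_mk]

/-- The two coordinates of a triple other than the `i`-th one. -/
def affinePart {s : ℝ} (i : Fin 3) (a : Fin 3 → CayleyAlgebra s) :
    CayleyAlgebra s × CayleyAlgebra s :=
  match i with
  | 0 => (a 1, a 2)
  | 1 => (a 0, a 2)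
  | 2 => (a 0, a 1)

theorem affinePart_triple {s : ℝ} (i : Fin 3) (x : CayleyAlgebra s × CayleyAlgebra s) :
    affinePart i (triple i x) = x := by
  fin_cases i <;> rfl

theorem triple_affinePart {s : ℝ} (i : Fin 3) {a : Fin 3 → CayleyAlgebra s} (ha : a i = 1) :
    triple i (affinePart i a) = a := by
  ext j : 1
  fin_cases i <;> fin_cases j <;> first | rfl | exact ha.symm

/-- The transition maps `φ_j ∘ φ_i⁻¹`. -/
def transition {s : ℝ} (i j : Fin 3) (x : CayleyAlgebra s × CayleyAlgebra s) :
    CayleyAlgebra s × CayleyAlgebra s :=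
  affinePart j fun m => triple i x m * (triple i x j)⁻¹

theorem triple_transition {s : ℝ} {i j : Fin 3} {x : CayleyAlgebra s × CayleyAlgebra s}
    (h : 0 < normSq (triple i x j)) :
    triple j (transition i j x) = fun m => triple i x m * (triple i x j)⁻¹ :=
  triple_affinePart j (by simpa using mul_mul_inv h 1)

theorem transition_mem {s : ℝ} {i j : Fin 3} {x : CayleyAlgebra s × CayleyAlgebra s}
    (hx : x ∈ coordDomain s) (h : 0 < normSq (triple i x j)) :
    transition i j x ∈ coordDomain s := by
  have hx' : 0 < 1 + normSq x.1 + normSq x.2 := hx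
  rw [← sum_normSq_triple i] at hx'
  have : 0 < ∑ m, normSq (triple j (transition i j x) m) := by
    rw [triple_transition h]
    simp only [normSq_mul, ← Finset.sum_mul, normSq_inv]
    exact mul_pos hx' (inv_pos.2 h)
  rwa [sum_normSq_triple] at this

theorem ofCoord_eq_iff_transition {s : ℝ} {i j : Fin 3} {x y : CayleyAlgebra s × CayleyAlgebra s}
    (hx : x ∈ coordDomain s) (hy : y ∈ coordDomain s) :
    ofCoord i x = ofCoord j y ↔ 0 < normSq (triple i x j) ∧ y = transition i j x := by
  rw [eq_comm, ofCoord_eq_iff hy hx, projRel_iff (triple_self j y)]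
  refine and_congr_right fun h => ?_
  constructor
  · intro H
    rw [← affinePart_triple j y, funext H]
    rfl
  · rintro rfl m
    rw [triple_transition h]

theorem ofCoord_injOn {s : ℝ} (i : Fin 3) : Set.InjOn (ofCoord (s := s) i) (coordDomain s) := by
  intro x hx y hy h
  rw [((ofCoord_eq_iff_transition hx hy).1 h).2, transition]
  simp only [triple_self, inv_one', mul_one]
  exact (affinePart_triple i x).symm

/-- The chart `φ_i : U_i/∼ → 𝔸²`: `φ₁[1, b, c] = (b, c)`, `φ₂[a, 1, c] = (a, c)`,
`φ₃[a, b, 1] = (a, b)`. -/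
def planeChart (s : ℝ) (i : Fin 3) : PartialEquiv (Plane s) (CayleyAlgebra s × CayleyAlgebra s) :=
  (Set.InjOn.toPartialEquiv (ofCoord i) (coordDomain s) (ofCoord_injOn i)).symm

theorem planeChart_target (s : ℝ) (i : Fin 3) : (planeChart s i).target = coordDomain s := rfl

theorem planeChart_source (s : ℝ) (i : Fin 3) :
    (planeChart s i).source = ofCoord i '' coordDomain s := rfl

theorem planeChart_symm_apply (s : ℝ) (i : Fin 3) (x : CayleyAlgebra s × CayleyAlgebra s) :
    (planeChart s i).symm x = ofCoord i x := rfl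

theorem planeChart_trans_source (s : ℝ) (i j : Fin 3) :
    ((planeChart s i).symm.trans (planeChart s j)).source =
      coordDomain s ∩ {x | 0 < normSq (triple i x j)} := by
  ext x
  simp only [PartialEquiv.trans_source, PartialEquiv.symm_source, planeChart_target,
    Set.mem_inter_iff, Set.mem_preimage, planeChart_symm_apply, planeChart_source, Set.mem_image,
    Set.mem_ofPred_eq]
  refine and_congr_right fun hx => ?_
  constructor
  · rintro ⟨y, hy, h⟩
    exact ((ofCoord_eq_iff_transition hx hy).1 h.symm).1
  · intro h
    exact ⟨transition i j x, transition_mem hx h,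
      ((ofCoord_eq_iff_transition hx (transition_mem hx h)).2 ⟨h, rfl⟩).symm⟩

theorem planeChart_trans_eqOn (s : ℝ) (i j : Fin 3) :
    Set.EqOn ((planeChart s i).symm.trans (planeChart s j)) (transition i j)
      (coordDomain s ∩ {x | 0 < normSq (triple i x j)}) := by
  rintro x ⟨hx, h⟩
  have h' : ofCoord i x = ofCoord j (transition i j x) :=
    (ofCoord_eq_iff_transition hx (transition_mem hx h)).2 ⟨h, rfl⟩
  change planeChart s j (ofCoord i x) = _
  rw [h', ← planeChart_symm_apply]
  exact (planeChart s j).right_inv (transition_mem hx h)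

theorem contDiff_triple {s : ℝ} (i j : Fin 3) :
    ContDiff ℝ ∞ fun x : CayleyAlgebra s × CayleyAlgebra s => triple i x j := by
  fin_cases i <;> fin_cases j <;>
    first | exact contDiff_const | exact contDiff_fst | exact contDiff_snd

theorem isOpen_coordDomain (s : ℝ) : IsOpen (coordDomain s) :=
  isOpen_lt continuous_const ((continuous_const.add (continuous_normSq.comp continuous_fst)).add
    (continuous_normSq.comp continuous_snd))

theorem isOpen_transition_source (s : ℝ) (i j : Fin 3) :
    IsOpen (coordDomain s ∩ {x | 0 < normSq (triple i x j)}) :=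
  (isOpen_coordDomain s).inter
    (isOpen_lt continuous_const (continuous_normSq.comp (contDiff_triple i j).continuous))

theorem contDiffOn_transition (s : ℝ) (i j : Fin 3) :
    ContDiffOn ℝ ∞ (transition i j)
      (coordDomain s ∩ {x : CayleyAlgebra s × CayleyAlgebra s | 0 < normSq (triple i x j)}) := by
  have h : ∀ m, ContDiffOn ℝ ∞
      (fun x : CayleyAlgebra s × CayleyAlgebra s => triple i x m * (triple i x j)⁻¹)
      (coordDomain s ∩ {x | 0 < normSq (triple i x j)}) := fun m =>
    contDiff_mul.comp_contDiffOn ((contDiff_triple i m).contDiffOn.prodMk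
      (((contDiff_normSq.comp (contDiff_triple i j)).contDiffOn.inv fun x hx => hx.2.ne').smul
        (contDiff_star.comp (contDiff_triple i j)).contDiffOn))
  fin_cases j
  · exact (h 1).prodMk (h 2)
  · exact (h 0).prodMk (h 2)
  · exact (h 0).prodMk (h 1)

theorem exists_mem_planeChart_source {s : ℝ} (p : Plane s) : ∃ i, p ∈ (planeChart s i).source := by
  obtain ⟨⟨a, ha⟩, rfl⟩ := Quotient.exists_rep p
  obtain ⟨i, hi, hpos⟩ := Set.mem_iUnion.1 ha
  have hx : affinePart i a ∈ coordDomain s := by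
    rw [← triple_affinePart i hi, sum_normSq_triple] at hpos
    exact hpos
  refine ⟨i, affinePart i a, hx, ?_⟩
  rw [ofCoord, dif_pos hx]
  exact congrArg Plane.mk (Subtype.ext (triple_affinePart i hi))

/-- The atlas `{φ₁, φ₂, φ₃}`. -/
def planeCore (s : ℝ) : ChartedSpaceCore (CayleyAlgebra s × CayleyAlgebra s) (Plane s) where
  atlas := Set.range (planeChart s)
  chartAt p := planeChart s (exists_mem_planeChart_source p).choose
  mem_chart_source p := (exists_mem_planeChart_source p).choose_spec
  chart_mem_atlas p := ⟨_, rfl⟩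
  open_source := by
    rintro _ _ ⟨i, rfl⟩ ⟨j, rfl⟩
    rw [planeChart_trans_source]
    exact isOpen_transition_source s i j
  continuousOn_toFun := by
    rintro _ _ ⟨i, rfl⟩ ⟨j, rfl⟩
    rw [planeChart_trans_source]
    exact (contDiffOn_transition s i j).continuousOn.congr (planeChart_trans_eqOn s i j)

instance (s : ℝ) : TopologicalSpace (Plane s) := (planeCore s).toTopologicalSpace

instance (s : ℝ) : ChartedSpace (CayleyAlgebra s × CayleyAlgebra s) (Plane s) :=
  (planeCore s).toChartedSpace

/-- The chart `φ_i` as a homeomorphism between open sets. -/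
def planeHomeo (s : ℝ) (i : Fin 3) :
    OpenPartialHomeomorph (Plane s) (CayleyAlgebra s × CayleyAlgebra s) :=
  (planeCore s).openPartialHomeomorph (planeChart s i) ⟨i, rfl⟩

theorem mem_atlas_plane_iff {s : ℝ}
    (e : OpenPartialHomeomorph (Plane s) (CayleyAlgebra s × CayleyAlgebra s)) :
    e ∈ atlas (CayleyAlgebra s × CayleyAlgebra s) (Plane s) ↔ ∃ i, e = planeHomeo s i := by
  change e ∈ ⋃ (f : PartialEquiv _ _) (hf : f ∈ (planeCore s).atlas), {_} ↔ _
  simp only [Set.mem_iUnion, Set.mem_singleton_iff]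
  constructor
  · rintro ⟨_, ⟨i, rfl⟩, h⟩
    exact ⟨i, h⟩
  · rintro ⟨i, h⟩
    exact ⟨_, ⟨i, rfl⟩, h⟩

instance (s : ℝ) : IsManifold 𝓘(ℝ, CayleyAlgebra s × CayleyAlgebra s) ∞ (Plane s) := by
  apply isManifold_of_contDiffOn
  intro e e' he he'
  obtain ⟨i, rfl⟩ := (mem_atlas_plane_iff e).1 he
  obtain ⟨j, rfl⟩ := (mem_atlas_plane_iff e').1 he'
  have hs : ((planeHomeo s i).symm ≫ₕ planeHomeo s j).source =
      coordDomain s ∩ {x | 0 < normSq (triple i x j)} := planeChart_trans_source s i j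
  simp only [modelWithCornersSelf_coe, modelWithCornersSelf_coe_symm, Set.preimage_id_eq, id_eq,
    Set.range_id, Set.inter_univ, Function.comp_id, Function.id_comp]
  rw [hs]
  exact (contDiffOn_transition s i j).congr (planeChart_trans_eqOn s i j)

theorem projRel_eq {s : ℝ} {i j : Fin 3} {x y : CayleyAlgebra s × CayleyAlgebra s}
    (h : ProjRel (triple i x) (triple j y)) :
    0 < normSq (triple i x j) ∧ ∀ m, triple i x m = triple j y m * triple i x j := by
  obtain ⟨l, hl, h⟩ := h
  have : triple i x j = l := by rw [h j, triple_self, one_mul]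
  rw [this]
  exact ⟨hl, h⟩

instance (s : ℝ) : T2Space (Plane s) := by
  rw [t2_iff_ultrafilter]
  intro p q f hp hq
  obtain ⟨i, hi⟩ := exists_mem_planeChart_source p
  obtain ⟨j, hj⟩ := exists_mem_planeChart_source q
  have hip : p ∈ (planeHomeo s i).source := hi
  have hjq : q ∈ (planeHomeo s j).source := hj
  have tx : Filter.Tendsto (planeHomeo s i) f (nhds (planeHomeo s i p)) :=
    ((planeHomeo s i).continuousAt hip).mono_left hp
  have ty : Filter.Tendsto (planeHomeo s j) f (nhds (planeHomeo s j q)) :=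
    ((planeHomeo s j).continuousAt hjq).mono_left hq
  have ei : ∀ r ∈ (planeHomeo s i).source, ofCoord i (planeHomeo s i r) = r :=
    fun r hr => (planeHomeo s i).left_inv hr
  have ej : ∀ r ∈ (planeHomeo s j).source, ofCoord j (planeHomeo s j r) = r :=
    fun r hr => (planeHomeo s j).left_inv hr
  have di : ∀ r ∈ (planeHomeo s i).source, planeHomeo s i r ∈ coordDomain s :=
    fun r hr => (planeHomeo s i).map_source hr
  have dj : ∀ r ∈ (planeHomeo s j).source, planeHomeo s j r ∈ coordDomain s :=
    fun r hr => (planeHomeo s j).map_source hr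
  have ev : ∀ᶠ r in (f : Filter (Plane s)), 0 < normSq (triple i (planeHomeo s i r) j) ∧
      ∀ m, triple i (planeHomeo s i r) m =
        triple j (planeHomeo s j r) m * triple i (planeHomeo s i r) j := by
    filter_upwards [hp ((planeHomeo s i).open_source.mem_nhds hip),
      hq ((planeHomeo s j).open_source.mem_nhds hjq)] with r hr hr'
    have he : ofCoord i (planeHomeo s i r) = ofCoord j (planeHomeo s j r) :=
      (ei r hr).trans (ej r hr').symm
    exact projRel_eq ((ofCoord_eq_iff (di r hr) (dj r hr')).1 he)
  have lx : ∀ m, Filter.Tendsto (fun r => triple i (planeHomeo s i r) m) f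
      (nhds (triple i (planeHomeo s i p) m)) := fun m =>
    ((contDiff_triple i m).continuous.tendsto _).comp tx
  have ly : ∀ m, Filter.Tendsto (fun r => triple j (planeHomeo s j r) m) f
      (nhds (triple j (planeHomeo s j q) m)) := fun m =>
    ((contDiff_triple j m).continuous.tendsto _).comp ty
  have hm : ∀ m, triple i (planeHomeo s i p) m =
      triple j (planeHomeo s j q) m * triple i (planeHomeo s i p) j := fun m =>
    tendsto_nhds_unique_of_eventuallyEq (lx m)
      ((ly m).mul (lx j))
      (ev.mono fun r hr => hr.2 m)
  have tn : Filter.Tendsto (fun r => normSq (triple i (planeHomeo s i r) j)) f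
      (nhds (normSq (triple i (planeHomeo s i p) j))) :=
    (continuous_normSq.tendsto (triple i (planeHomeo s i p) j)).comp (lx j)
  have h0 : 0 ≤ normSq (triple i (planeHomeo s i p) j) :=
    ge_of_tendsto tn (ev.mono fun r hr => hr.1.le)
  have h1 : normSq (triple i (planeHomeo s i p) j) ≠ 0 := fun h => by
    have := congrArg normSq (hm i)
    rw [triple_self, normSq_mul, h, mul_zero, normSq_one] at this
    exact one_ne_zero this
  rw [← ei p hip, ← ej q hjq, ofCoord_eq_iff (di p hip) (dj q hjq)]
  exact ⟨_, lt_of_le_of_ne h0 h1.symm, hm⟩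

instance (s : ℝ) : SecondCountableTopology (Plane s) := by
  have hc : (⋃ i, (planeHomeo s i).source) = Set.univ :=
    Set.eq_univ_of_forall fun p => Set.mem_iUnion.2 (exists_mem_planeChart_source p)
  have : ∀ i, SecondCountableTopology ((planeHomeo s i).source) := fun i =>
    (planeHomeo s i).secondCountableTopology_source
  exact TopologicalSpace.secondCountableTopology_of_countable_cover
    (fun i => (planeHomeo s i).open_source) hc

/-- The symmetric bilinear form at `(u, v)` whose quadratic form is
`(|du|² (1 + k|v|²) + |dv|² (1 + k|u|²) - 2k Re ((u v̄) (dv dū))) / (1 + k|u|² + k|v|²)²`. -/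
def fubiniStudyForm {s : ℝ} (k : ℝ) (x : CayleyAlgebra s × CayleyAlgebra s) :
    (CayleyAlgebra s × CayleyAlgebra s) →L[ℝ] (CayleyAlgebra s × CayleyAlgebra s) →L[ℝ] ℝ :=
  LinearMap.toContinuousBilinearMap <| LinearMap.mk₂ ℝ
    (fun a b => (ip a.1 b.1 * (1 + k * normSq x.2) + ip a.2 b.2 * (1 + k * normSq x.1)
      - k * (re ((x.1 * star x.2) * (a.2 * star b.1)) + re ((x.1 * star x.2) * (b.2 * star a.1))))
        / (1 + k * normSq x.1 + k * normSq x.2) ^ 2)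
    (fun a a' b => by
      simp only [Prod.fst_add, Prod.snd_add, ip, star_add', add_mul, mul_add, re_add]; ring)
    (fun r a b => by
      simp only [Prod.smul_fst, Prod.smul_snd, ip, star_smul', smul_mul_assoc, mul_smul_comm,
        re_smul, smul_eq_mul]
      ring)
    (fun a b b' => by
      simp only [Prod.fst_add, Prod.snd_add, ip, star_add', add_mul, mul_add, re_add]; ring)
    (fun r a b => by
      simp only [Prod.smul_fst, Prod.smul_snd, ip, star_smul', smul_mul_assoc, mul_smul_comm,
        re_smul, smul_eq_mul]
      ring)

theorem fubiniStudyForm_apply {s : ℝ} (k : ℝ) (x a b : CayleyAlgebra s × CayleyAlgebra s) :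
    fubiniStudyForm k x a b =
      (ip a.1 b.1 * (1 + k * normSq x.2) + ip a.2 b.2 * (1 + k * normSq x.1)
      - k * (re ((x.1 * star x.2) * (a.2 * star b.1)) + re ((x.1 * star x.2) * (b.2 * star a.1))))
        / (1 + k * normSq x.1 + k * normSq x.2) ^ 2 := rfl

/-- The formula for `ds²` in the coordinates `(u, v)`, at the tangent vector `(du, dv)`. -/
theorem fubiniStudyForm_self {s : ℝ} (u v du dv : CayleyAlgebra s) :
    fubiniStudyForm 1 (u, v) (du, dv) (du, dv) =
      (normSq du * (1 + normSq v) + normSq dv * (1 + normSq u)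
        - 2 * re ((u * star v) * (dv * star du))) / (1 + normSq u + normSq v) ^ 2 := by
  simp only [fubiniStudyForm_apply, normSq]
  ring

/-- The formula for `ds²` on the hyperbolic plane. -/
theorem fubiniStudyForm_neg_one_self {s : ℝ} (u v du dv : CayleyAlgebra s) :
    fubiniStudyForm (-1) (u, v) (du, dv) (du, dv) =
      (normSq du * (1 - normSq v) + normSq dv * (1 - normSq u)
        + 2 * re ((u * star v) * (dv * star du))) / (1 - normSq u - normSq v) ^ 2 := by
  simp only [fubiniStudyForm_apply, normSq]
  ring

/-- The metric of the projective plane: in the coordinates of the preferred chart at `p`, it is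
given at `p` by `fubiniStudyForm 1`. -/
def planeMetric (s : ℝ) (p : Plane s) :
    TangentSpace 𝓘(ℝ, CayleyAlgebra s × CayleyAlgebra s) p →L[ℝ]
      TangentSpace 𝓘(ℝ, CayleyAlgebra s × CayleyAlgebra s) p →L[ℝ] ℝ :=
  fubiniStudyForm 1 (chartAt (CayleyAlgebra s × CayleyAlgebra s) p p)

/-- The octonionic hyperbolic plane `𝕆H² = {(u, v) ∈ 𝕆² : |u|² + |v|² < 1}`, an open submanifold
of `𝕆²`. -/
def HyperbolicPlane : TopologicalSpace.Opens (Octonion × Octonion) where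
  carrier := {x | normSq x.1 + normSq x.2 < 1}
  is_open' := isOpen_lt ((continuous_normSq.comp continuous_fst).add
    (continuous_normSq.comp continuous_snd)) continuous_const

/-- The metric of `𝕆H²`. -/
def hyperbolicMetric (p : HyperbolicPlane) :
    TangentSpace 𝓘(ℝ, Octonion × Octonion) p →L[ℝ]
      TangentSpace 𝓘(ℝ, Octonion × Octonion) p →L[ℝ] ℝ :=
  fubiniStudyForm (-1) p.1

end

noncomputable section

open CayleyAlgebra

/-! ### Algebra of the triple system -/

/-! Let `Q a = T a a / 2`, on pairs of octonions the Hermitian matrix `a a*` acting from the left.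
With `N = 1 + k|x|²`, each of the three metrics is `G(a, b) = B(S a, b)` with `S = N⁻² (N - k Q x)`,
where `k = 1` for the projective planes and `k = -1` for the hyperbolic one. The curvature is
computed at all points at once, with no appeal to homogeneity: the Christoffel symbols are `-(k/N) D
x a b`, where `D` is linear in the point `x`.

The part of the Jacobi operator with factor `k/N` is its value at the origin, `B(v, v) y + 3 Q v y -
4 B(v, y) v` (`D_sub_D`). The part with factor `k²/N²` is minus the same expression with `B(·, ·)`
replaced by `B(Q x ·, ·)` and `Q v` by `Q v ∘ Q x` (`D_D`). The two coefficients are those of `S`,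
so the sum is `J v y = k (G(v, v) y + 3 K v y - 4 G(v, y) v)` with `K v = Q v ∘ S` (`J_eq`).

Everything else is a statement about `K v`. It is `G`-symmetric, fixes `v` up to the factor `ε =
G(v, v)`, satisfies `(K v)² = ε K v` and has trace `8 ε`. For unit `v`, `ε K v` is therefore the
orthogonal projection onto an 8-dimensional line through `v`. The operator `J v` is `0` on `v`,
`4kε` on the rest of the line and `kε` on the kernel of `K v`. Condition (II) holds because `Q w` is
a multiple of `Q v` for every `w` on the line of `v` (`K_eq_of_mem`). Condition (III) follows from
`Q w S Q v + Q v S Q w = T w (Q v S w)` (`T_T_S`, `K_symm`).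

The identities of a `LineTriple` hold for pairs over either algebra by alternativity and its
polarizations; only `T_image` also needs the middle Moufang identity. The expressions of the metric
in the three charts agree because every transition map is composed of the swap and `(u, v) ↦ (u⁻¹, v
u⁻¹)`, which preserve the metric. -/

/-- A symmetric bilinear form `B` and a symmetric bilinear map `T` to the endomorphisms, with the
identities satisfied on pairs of octonions by `T a a = 2 Q a`, where `Q a` is the multiple of the
projection onto the octonionic line through `a`. -/
structure LineTriple (V : Type*) [AddCommGroup V] [Module ℝ V] where
  /-- The bilinear form. -/
  B : V →ₗ[ℝ] V →ₗ[ℝ] ℝ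
  /-- The polarized line operators. -/
  T : V →ₗ[ℝ] V →ₗ[ℝ] V →ₗ[ℝ] V
  B_comm : ∀ a b, B a b = B b a
  B_nondeg : ∀ a, (∀ b, B a b = 0) → a = 0
  T_comm : ∀ a b x, T a b x = T b a x
  T_symm : ∀ a b x y, B (T a b x) y = B x (T a b y)
  T_swap : ∀ a b x y, B (T a b x) y = B (T x y a) b
  T_cyc : ∀ a b c, T a b c + T b c a + T c a b = (2 : ℝ) • (B a b • c + B b c • a + B c a • b)
  T_T_self : ∀ v x, T v v (T x x v) = (2 * B (T x x v) v) • v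
  T_mul : ∀ v x y, (2 : ℝ) • T v (T x x v) y = T x x (T v v y) + T v v (T x x y)
  T_T_T : ∀ v x y, T v v (T x x (T v v y)) = (2 * B (T x x v) v) • T v v y
  T_image : ∀ x v w y, (2 : ℝ) • T (T x x w) (T v v w) y =
    T x x (T w w (T v v y)) + T v v (T w w (T x x y))
  finrank_eq : Module.finrank ℝ V = 16
  trace_T : ∀ a b, LinearMap.trace ℝ V (T a b) = 16 * B a b

namespace LineTriple

variable {V : Type*} [AddCommGroup V] [Module ℝ V] (H : LineTriple V) (k : ℝ) (x : V)

/-! ### Consequences and polarizations of the axioms -/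

theorem T_self (v : V) : H.T v v v = (2 * H.B v v) • v := by
  have h := H.T_cyc v v v
  linear_combination (norm := module) (1 / 3 : ℝ) • h

theorem T_sq (v y : V) : H.T v v (H.T v v y) = (2 * H.B v v) • H.T v v y := by
  have h := H.T_mul v v y
  rw [H.T_self] at h
  simp only [map_smul, LinearMap.smul_apply] at h
  linear_combination (norm := module) (-1 / 2 : ℝ) • h

theorem T_self_right (v w : V) :
    (2 : ℝ) • H.T v w v = (2 * H.B v v) • w + (4 * H.B v w) • v - H.T v v w := by
  have h := H.T_cyc v w v
  rw [H.T_comm w v v, H.B_comm w v] at h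
  linear_combination (norm := module) h

theorem B_T_T (a b x : V) : H.B (H.T a b x) x = H.B (H.T x x a) b := H.T_swap a b x x

/-- Polarization of `T_T_self` in `v`. -/
theorem T_T_left (v w x : V) :
    (2 : ℝ) • H.T v w (H.T x x v) + H.T v v (H.T x x w) =
      (2 * H.B (H.T x x v) v) • w + (4 * H.B (H.T x x v) w) • v := by
  -- `T_T_self` is cubic in `v`. Half the difference of its values at `v + w` and `v - w` keeps the
  -- terms of degree one and three in `w`, and `h₃` removes the latter.
  have h₁ := H.T_T_self (v + w) x
  have h₂ := H.T_T_self (v - w) x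
  have h₃ := H.T_T_self w x
  have e₁ : H.B (H.T x x w) v = H.B (H.T x x v) w := by rw [H.T_symm, H.B_comm]
  simp only [map_add, map_sub, LinearMap.add_apply, LinearMap.sub_apply, H.T_comm w v, e₁]
    at h₁ h₂
  linear_combination (norm := module) (1 / 2 : ℝ) • h₁ - (1 / 2 : ℝ) • h₂ - h₃

/-- Polarization of `T_T_self` in both variables. -/
theorem T_T_polar (v w x y : V) :
    (2 : ℝ) • H.T v w (H.T x y v) + H.T v v (H.T x y w) =
      (2 * H.B (H.T x y v) v) • w + (4 * H.B (H.T x y v) w) • v := by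
  have h₁ := H.T_T_left v w (x + y)
  have h₂ := H.T_T_left v w x
  have h₃ := H.T_T_left v w y
  simp only [map_add, LinearMap.add_apply, H.T_comm y x] at h₁
  linear_combination (norm := module) (1 / 2 : ℝ) • (h₁ - h₂ - h₃)

/-- Polarization of `T_mul` in `v`. -/
theorem T_mul_left (v w x y : V) :
    H.T v (H.T x x w) y + H.T w (H.T x x v) y = H.T x x (H.T v w y) + H.T v w (H.T x x y) := by
  have h₁ := H.T_mul (v + w) x y
  have h₂ := H.T_mul v x y
  have h₃ := H.T_mul w x y
  simp only [map_add, LinearMap.add_apply, H.T_comm w v] at h₁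
  linear_combination (norm := module) (1 / 2 : ℝ) • (h₁ - h₂ - h₃)

/-- Polarization of `T_mul` in both variables. -/
theorem T_mul_polar (v w x z y : V) :
    H.T v (H.T x z w) y + H.T w (H.T x z v) y = H.T x z (H.T v w y) + H.T v w (H.T x z y) := by
  have h₁ := H.T_mul_left v w (x + z) y
  have h₂ := H.T_mul_left v w x y
  have h₃ := H.T_mul_left v w z y
  simp only [map_add, LinearMap.add_apply, H.T_comm z x] at h₁
  linear_combination (norm := module) (1 / 2 : ℝ) • (h₁ - h₂ - h₃)

/-! ### The triple product, which gives the Christoffel symbols -/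

/-- The triple product `{a x b}`. -/
def D : V →ₗ[ℝ] V →ₗ[ℝ] V →ₗ[ℝ] V :=
  LinearMap.mk₂ ℝ
    (fun x a => (2 * H.B a x) • LinearMap.id + (2 : ℝ) • (H.B x).smulRight a - (H.T a).flip x)
    (fun x y a => by ext b; simp; module) (fun r x a => by ext b; simp; module)
    (fun x a b => by ext c; simp; module) (fun r x a => by ext b; simp; module)

theorem D_apply (x a b : V) :
    H.D x a b = (2 * H.B a x) • b + (2 * H.B b x) • a - H.T a b x := by
  simp [D, smul_smul, H.B_comm x b]

/-- Up to the factor `k`, this is the Jacobi operator at the origin: the Christoffel symbols vanish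
there and only their derivatives contribute. -/
theorem D_sub_D (a y : V) :
    H.D a y a - H.D y a a = H.B a a • y + (3 / 2 : ℝ) • H.T a a y - (4 * H.B a y) • a := by
  simp only [D_apply]
  have h := H.T_self_right a y
  rw [H.T_comm y a, H.B_comm y a]
  linear_combination (norm := module) (-1 / 2 : ℝ) • h

theorem T_self_right' (v w : V) :
    H.T v w v = H.B v v • w + (2 * H.B v w) • v - (1 / 2 : ℝ) • H.T v v w := by
  linear_combination (norm := module) (1 / 2 : ℝ) • H.T_self_right v w

/-- The left side collects the derivatives of `1/N` and the products of Christoffel symbols. The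
right side is minus that of `D_sub_D`, with `B(a, ·)` replaced by `B(T x x a, ·) / 2` and `T a a` by
`T a a ∘ T x x / 2`. This match is what makes `S` reappear in the curvature. -/
theorem D_D (a y : V) :
    (2 * H.B x y) • H.D x a a - (2 * H.B x a) • H.D x y a + H.D x y (H.D x a a)
        - H.D x a (H.D x y a) =
      (2 * H.B (H.T x x a) y) • a - (1 / 2 * H.B (H.T x x a) a) • y
        - (3 / 4 : ℝ) • H.T a a (H.T x x y) := by
  -- `h₁` and `h₂` turn operators indexed by a value of `T` into compositions, so that `h₃`, `h₄`
  -- and `h₅` apply to what remains.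
  have h₁ : H.T y (H.T a a x) x = H.T a a (H.T x y x) + H.T x y (H.T a a x)
      - H.T x (H.T a a y) x := by
    have h := H.T_mul_left y x a x
    rw [H.T_comm y x, H.T_comm y x] at h
    linear_combination (norm := module) h
  have h₂ : H.T a (H.T a y x) x = H.T a y (H.T x a x) + H.T x a (H.T a y x)
      - H.T x (H.T a y a) x := by
    have h := H.T_mul_polar a x a y x
    rw [H.T_comm a x, H.T_comm a x] at h
    linear_combination (norm := module) h
  have h₃ := H.T_T_left x y a
  have h₄ := H.T_T_polar x a a y
  have h₅ := H.T_T_left a y x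
  have e₁ : H.B (H.T a y x) x = H.B (H.T x x a) y := H.B_T_T a y x
  have e₂ : H.B (H.T a a x) x = H.B (H.T x x a) a := H.B_T_T a a x
  have e₃ : H.B x (H.T a a y) = H.B (H.T a a x) y := (H.T_symm a a x y).symm
  have e₄ : H.B (H.T a y x) a = H.B a a * H.B x y + 2 * H.B a y * H.B x a
      - 1 / 2 * H.B (H.T a a x) y := by
    rw [H.T_symm, T_self_right']
    simp only [map_add, map_sub, map_smul, smul_eq_mul, e₃]
  simp only [D_apply, H.T_comm y a, map_add, map_sub, map_smul, LinearMap.add_apply,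
    LinearMap.sub_apply, LinearMap.smul_apply, h₁, h₂, H.T_self_right', e₁, e₂, e₃,
    H.B_comm y x, H.B_comm a x] at h₃ h₄ h₅ ⊢
  rw [e₄] at h₄
  linear_combination (norm := module) (1 / 2 : ℝ) • h₃ - (1 / 2 : ℝ) • h₄
    + (1 / 4 : ℝ) • h₅

/-! ### The metric at a point and the projections onto lines -/

/-- The conformal factor `1 + k|x|²`. -/
def N : ℝ := 1 + k * H.B x x

/-- The operator that represents the metric at `x` with respect to `B`. -/
def S : V →ₗ[ℝ] V :=
  (H.N k x ^ 2)⁻¹ • (H.N k x • LinearMap.id - (k / 2) • H.T x x)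

/-- The metric at `x`. -/
def G : V →ₗ[ℝ] V →ₗ[ℝ] ℝ := H.B.comp (H.S k x)

/-- The multiple of the `G`-orthogonal projection onto the octonionic line through `v`. -/
def K (v : V) : V →ₗ[ℝ] V := (1 / 2 : ℝ) • (H.T v v).comp (H.S k x)

theorem S_apply (y : V) :
    H.S k x y = (H.N k x ^ 2)⁻¹ • (H.N k x • y - (k / 2) • H.T x x y) := rfl

theorem G_apply (a b : V) : H.G k x a b = H.B (H.S k x a) b := rfl

theorem K_apply (v y : V) : H.K k x v y = (1 / 2 : ℝ) • H.T v v (H.S k x y) := rfl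

theorem G_eq (a b : V) : H.G k x a b =
    (H.N k x * H.B a b - k / 2 * H.B (H.T x x a) b) / H.N k x ^ 2 := by
  simp only [G_apply, S_apply, map_smul, map_sub, LinearMap.smul_apply, LinearMap.sub_apply,
    smul_eq_mul]
  ring

theorem G_eq_diag (v w : V) : H.G k x v w =
    (H.N k x * H.B v w - k / 2 * (H.B.comp (H.T v w)) x x) / H.N k x ^ 2 := by
  rw [G_eq, ← H.B_T_T]
  rfl

theorem B_S (a b : V) : H.B (H.S k x a) b = H.B a (H.S k x b) := by
  simp only [S_apply, map_smul, map_sub, LinearMap.smul_apply, LinearMap.sub_apply,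
    smul_eq_mul, H.T_symm]

theorem G_comm (a b : V) : H.G k x a b = H.G k x b a := by
  rw [G_apply, B_S, H.B_comm, G_apply]

/-- On the image of `T x x` the operator `N - (k/2) T x x` acts as `N - k B x x = 1`. Applying `T x
x` to the equation thus gives `T x x a = 0`, which leaves `N a = 0`. -/
theorem S_injective (hN : H.N k x ≠ 0) {a : V} (ha : H.S k x a = 0) : a = 0 := by
  have h : H.N k x • a - (k / 2) • H.T x x a = 0 := by
    rw [S_apply, smul_eq_zero] at ha
    exact ha.resolve_left (inv_ne_zero (pow_ne_zero 2 hN))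
  have h' := congrArg (H.T x x) h
  simp only [map_sub, map_smul, map_zero, H.T_sq] at h'
  have h'' : H.T x x a = 0 := by
    rw [N] at h'
    linear_combination (norm := module) h'
  rw [h'', smul_zero, sub_zero] at h
  exact (smul_eq_zero.1 h).resolve_left hN

theorem G_nondeg (hN : H.N k x ≠ 0) {a : V} (ha : ∀ b, H.G k x a b = 0) : a = 0 :=
  H.S_injective k x hN (H.B_nondeg _ ha)

theorem G_K (v y z : V) : H.G k x (H.K k x v y) z = H.G k x y (H.K k x v z) := by
  simp only [G_apply, K_apply, map_smul, LinearMap.smul_apply, B_S, H.T_symm]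

/-- The identity part of `S` is handled by `T_sq`, the part with `T x x` by `T_T_T`; the two scalars
add up to `2 G v v`. This is the source of `K_sq`. -/
theorem T_S_T (v y : V) :
    H.T v v (H.S k x (H.T v v y)) = (2 * H.G k x v v) • H.T v v y := by
  rw [S_apply, G_eq, map_smul, map_sub, map_smul, map_smul, H.T_sq, H.T_T_T]
  module

theorem T_S_self (v : V) : H.T v v (H.S k x v) = (2 * H.G k x v v) • v := by
  rw [S_apply, G_eq, map_smul, map_sub, map_smul, map_smul, H.T_self, H.T_T_self]
  module

theorem K_sq (v y : V) : H.K k x v (H.K k x v y) = H.G k x v v • H.K k x v y := by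
  simp only [K_apply, map_smul, T_S_T]
  module

theorem K_self (v : V) : H.K k x v v = H.G k x v v • v := by
  rw [K_apply, T_S_self]
  module

/-- The diagonal case of `T_image`: points of one line have proportional operators. The factor is
zero at null points, which is why `K_eq_of_mem` has to identify it. -/
theorem T_T_T_T (v y z : V) :
    H.T (H.T v v y) (H.T v v y) z = (2 * H.B (H.T v v y) y) • H.T v v z := by
  have h := H.T_image v v y z
  rw [H.T_T_T, H.B_T_T] at h
  linear_combination (norm := module) (1 / 2 : ℝ) • h

/-- Octonionic lines through the origin are determined by any of their non-null vectors. -/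
theorem K_eq_of_mem {v w : V} (hv : H.G k x v v ^ 2 = 1) (h : H.K k x v w = H.G k x v v • w)
    (y : V) : H.K k x w y = (H.G k x v v * H.G k x w w) • H.K k x v y := by
  -- As `G v v` is its own inverse, the hypothesis exhibits `w` as a value of `T v v`, to which
  -- `T_T_T_T` applies.
  have hw : w = (H.G k x v v / 2) • H.T v v (H.S k x w) := by
    have h' : H.G k x v v • H.K k x v w = w := by
      rw [h, smul_smul, ← pow_two, hv, one_smul]
    rw [K_apply, smul_smul] at h'
    rw [mul_one_div] at h'
    exact h'.symm
  have hg : H.B (H.T v v (H.S k x w)) (H.S k x w) = 2 * H.G k x v v * H.G k x w w := by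
    have h' : (1 / 2 : ℝ) • H.T v v (H.S k x w) = H.G k x v v • w := h
    have h'' := congrArg (fun z => H.B z (H.S k x w)) h'
    simp only [map_smul, LinearMap.smul_apply, smul_eq_mul] at h''
    rw [H.G_apply k x w w, H.B_S]
    linear_combination 2 * h''
  have key : ∀ z, H.T w w z = (H.G k x v v * H.G k x w w) • H.T v v z := by
    intro z
    have e : H.T w w z = (H.G k x v v / 2) • (H.G k x v v / 2) •
        H.T (H.T v v (H.S k x w)) (H.T v v (H.S k x w)) z := by
      conv_lhs => rw [hw]
      simp only [map_smul, LinearMap.smul_apply]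
    rw [e, T_T_T_T, hg]
    match_scalars
    linear_combination (H.G k x v v * H.G k x w w) * hv
  rw [K_apply, K_apply, key]
  module

/-- The analogue of `T_mul` with `S` inserted. The identity part of `S` gives `T_mul` itself. For
the part with `T x x`, polarized `T_mul` produces the extra term `T (T x x w) (T v v w)`, which
`T_image` evaluates, and two applications of `T_mul` expand `T w (T x x w)`. -/
theorem T_T_S (v w y : V) :
    (2 : ℝ) • H.T w (H.T v v (H.S k x w)) y =
      H.T w w (H.S k x (H.T v v y)) + H.T v v (H.S k x (H.T w w y)) := by
  have h₁ := H.T_mul w v y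
  have h₂ := H.T_mul_left w (H.T x x w) v y
  have h₃ := H.T_mul w x (H.T v v y)
  have h₄ := congrArg (H.T v v) (H.T_mul w x y)
  have h₅ := H.T_image x v w y
  simp only [S_apply, map_smul, map_sub, LinearMap.smul_apply, LinearMap.sub_apply, map_add]
    at h₂ h₄ ⊢
  linear_combination (norm := module) (H.N k x ^ 2)⁻¹ • (H.N k x • h₁ -
    (k / 2) • ((2 : ℝ) • h₂ - h₅ + h₃ + h₄))

/-- If `T v v S w = 0`, then `T_T_S` makes `T w w S T v v + T v v S T w w` vanish. Evaluated at `S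
v`, this says that `z = T w w S v` satisfies `2 G(v, v) z + T v v S z = 0`. Applying `T v v S` once
more gives `T v v S z = 0`, and then `z = 0`. Nothing is assumed on `G(w, w)`. -/
theorem K_symm {v w : V} (hv : H.G k x v v ≠ 0) (h : H.K k x v w = 0) : H.K k x w v = 0 := by
  have h' : H.T v v (H.S k x w) = 0 := by simpa [K_apply] using h
  have h₁ := H.T_T_S k x v w (H.S k x v)
  rw [h', map_zero, LinearMap.zero_apply, smul_zero, T_S_self, map_smul, map_smul] at h₁
  have h₂ := congrArg (fun z => H.T v v (H.S k x z)) h₁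
  simp only [map_zero, map_add, map_smul, T_S_T] at h₂
  have h₃ : H.T v v (H.S k x (H.T w w (H.S k x v))) = 0 := by
    have : (4 * H.G k x v v) • H.T v v (H.S k x (H.T w w (H.S k x v))) = 0 := by
      linear_combination (norm := module) -h₂
    exact (smul_eq_zero.1 this).resolve_left (mul_ne_zero four_ne_zero hv)
  rw [h₃, add_zero] at h₁
  rw [K_apply, (smul_eq_zero.1 h₁.symm).resolve_left (mul_ne_zero two_ne_zero hv), smul_zero]

/-- Taking traces in `T_mul` and using cyclicity evaluates the trace of `T v v ∘ T x x` as `16 B(T x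
x v, v)`; the rest is linear in `S`. -/
theorem trace_K [FiniteDimensional ℝ V] (v : V) :
    LinearMap.trace ℝ V (H.K k x v) = 8 * H.G k x v v := by
  have h₁ : (2 : ℝ) • H.T v (H.T x x v) = (H.T x x) ∘ₗ (H.T v v) + (H.T v v) ∘ₗ (H.T x x) :=
    LinearMap.ext (H.T_mul v x)
  have h₂ := congrArg (LinearMap.trace ℝ V) h₁
  rw [map_smul, map_add, H.trace_T, H.B_comm v,
    LinearMap.trace_comp_comm' (H.T v v) (H.T x x)] at h₂
  have h₃ : H.K k x v = (1 / 2 : ℝ) • (H.N k x ^ 2)⁻¹ • (H.N k x • H.T v v -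
      (k / 2) • (H.T v v) ∘ₗ (H.T x x)) := by
    ext y
    simp [K_apply, S_apply]
  rw [h₃, G_eq]
  simp only [map_smul, map_sub, H.trace_T, smul_eq_mul] at h₂ ⊢
  linear_combination (H.N k x ^ 2)⁻¹ * (k / 8) * h₂

/-! ### The Jacobi operator and the Christoffel symbols in algebraic form -/

/-- The Jacobi operator at `x`. -/
def J (v : V) : V →ₗ[ℝ] V :=
  k • (H.G k x v v • LinearMap.id + (3 : ℝ) • H.K k x v - (4 : ℝ) • (H.G k x v).smulRight v)

theorem J_apply (v y : V) :
    H.J k x v y = k • (H.G k x v v • y + (3 : ℝ) • H.K k x v y - (4 * H.G k x v y) • v) := by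
  simp [J, smul_smul]

/-- The right side is what the curvature formula yields for the Christoffel symbols `-(k/N) D x`. By
`D_sub_D` and `D_D`, each of the three terms of `J` receives the coefficients `1/N` and `-k/N²` of
`S`. -/
theorem J_eq (hN : H.N k x ≠ 0) (v y : V) : H.J k x v y =
    (k / H.N k x) • (H.D v y v - H.D y v v) + (k ^ 2 / H.N k x ^ 2) •
      ((2 * H.B x y) • H.D x v v - (2 * H.B x v) • H.D x y v + H.D x y (H.D x v v)
        - H.D x v (H.D x y v)) := by
  rw [D_sub_D, D_D, J_apply, K_apply, S_apply, G_eq, G_eq]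
  simp only [map_sub, map_smul]
  match_scalars <;> field_simp <;> ring

/-- `G` is the metric and `-(k / N) • D` are its Christoffel symbols. -/
theorem G_D (a b c : V) (hN : H.N k x ≠ 0) :
    H.G k x (-(k / H.N k x) • H.D x a b) c =
      (-(k / H.N k x ^ 2) * (H.B x a * H.B b c + H.B x b * H.B a c - H.B x c * H.B a b)
       - k / 2 / H.N k x ^ 2 *
          (H.B (H.T x a b) c + H.B (H.T x b a) c - H.B (H.T x c a) b)
       + k ^ 2 / H.N k x ^ 3 * (H.B x a * H.B (H.T x x b) c + H.B x b * H.B (H.T x x a) c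
          - H.B x c * H.B (H.T x x a) b)) := by
  have h₁ := congrArg (fun z => H.B z c) (H.T_cyc x a b)
  -- For `v = w = x` the left side of `T_T_polar` is three times this term.
  have h₂ : H.T x x (H.T a b x) = (2 * H.B (H.T x x a) b) • x := by
    have h := H.T_T_polar x x a b
    rw [H.B_T_T] at h
    linear_combination (norm := module) (1 / 3 : ℝ) • h
  have h₃ := H.T_swap x c a b
  rw [D_apply, G_eq]
  simp only [map_add, map_sub, map_smul, LinearMap.add_apply, LinearMap.sub_apply,
    LinearMap.smul_apply, smul_eq_mul, h₂, h₃, H.B_comm a x, H.B_comm b x, H.T_comm b x] at h₁ ⊢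
  field_simp
  linear_combination (H.N k x) * k * h₁

theorem G_self_K (v y : V) : H.G k x v (H.K k x v y) = H.G k x v v * H.G k x v y := by
  rw [← G_K, K_self, map_smul, LinearMap.smul_apply, smul_eq_mul]

theorem G_self_J (v y : V) : H.G k x v (H.J k x v y) = 0 := by
  simp only [J_apply, map_smul, map_sub, map_add, G_self_K, smul_eq_mul]
  ring

/-! ### Spectrum of the Jacobi operator and the three Osserman conditions -/

variable {k x} {v : V}

/-- All values of `J v` are orthogonal to `v`, hence so is an eigenvector with non-zero eigenvalue.
On `v^⊥` the operator reduces to `k (G v v + 3 K v)`. -/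
theorem J_eq_four_smul_iff (hk : k ≠ 0) (hv : H.G k x v v ≠ 0) (y : V) :
    H.J k x v y = (H.G k x v v * (4 * k)) • y ↔
      H.K k x v y = H.G k x v v • y ∧ H.G k x v y = 0 := by
  constructor
  · intro h
    have h' := congrArg (H.G k x v) h
    rw [G_self_J, map_smul, smul_eq_mul] at h'
    have h₀ : H.G k x v y = 0 := by
      have : H.G k x v v * (4 * k) ≠ 0 := by positivity
      exact (mul_eq_zero.1 h'.symm).resolve_left this
    refine ⟨?_, h₀⟩
    rw [J_apply, h₀] at h
    have : (3 * k) • (H.K k x v y - H.G k x v v • y) = 0 := by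
      linear_combination (norm := module) h
    exact sub_eq_zero.1 ((smul_eq_zero.1 this).resolve_left (by positivity))
  · rintro ⟨h₁, h₂⟩
    rw [J_apply, h₁, h₂]
    module

theorem J_eq_smul_iff (hk : k ≠ 0) (hv : H.G k x v v ≠ 0) (y : V) :
    H.J k x v y = (H.G k x v v * k) • y ↔ H.K k x v y = 0 := by
  constructor
  · intro h
    have h' := congrArg (H.G k x v) h
    rw [G_self_J, map_smul, smul_eq_mul] at h'
    have h₀ : H.G k x v y = 0 := by
      have : H.G k x v v * k ≠ 0 := by positivity
      exact (mul_eq_zero.1 h'.symm).resolve_left this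
    rw [J_apply, h₀] at h
    have : (3 * k) • H.K k x v y = 0 := by
      linear_combination (norm := module) h
    exact (smul_eq_zero.1 this).resolve_left (by positivity)
  · intro h
    have h₀ : H.G k x v y = 0 := by
      have := H.G_self_K k x v y
      rw [h, map_zero] at this
      exact (mul_eq_zero.1 this.symm).resolve_left hv
    rw [J_apply, h, h₀]
    module

theorem mem_range_K_iff (hv : H.G k x v v ^ 2 = 1) {y : V} :
    y ∈ LinearMap.range (H.K k x v) ↔ H.K k x v y = H.G k x v v • y := by
  constructor
  · rintro ⟨z, rfl⟩
    exact H.K_sq k x v z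
  · intro h
    refine ⟨H.G k x v v • y, ?_⟩
    rw [map_smul, h, smul_smul, ← pow_two, hv, one_smul]

/-- The rank of the projection `G v v • K v` is its trace, `8 (G v v)² = 8`. -/
theorem finrank_range_K [FiniteDimensional ℝ V] (hv : H.G k x v v ^ 2 = 1) :
    Module.finrank ℝ (LinearMap.range (H.K k x v)) = 8 := by
  have h : LinearMap.IsProj (LinearMap.range (H.K k x v)) (H.G k x v v • H.K k x v) := by
    refine ⟨fun y => Submodule.smul_mem _ _ ⟨y, rfl⟩, fun y hy => ?_⟩
    rw [LinearMap.smul_apply, (H.mem_range_K_iff hv).1 hy, smul_smul, ← pow_two, hv, one_smul]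
  have h' := h.trace
  rw [map_smul, trace_K, smul_eq_mul] at h'
  have : (Module.finrank ℝ (LinearMap.range (H.K k x v)) : ℝ) = 8 := by
    linear_combination 8 * hv - h'
  exact_mod_cast this

theorem finrank_ker_K [FiniteDimensional ℝ V] (hv : H.G k x v v ^ 2 = 1) :
    Module.finrank ℝ (LinearMap.ker (H.K k x v)) = 8 := by
  have h := LinearMap.finrank_range_add_finrank_ker (H.K k x v)
  rw [H.finrank_range_K hv, H.finrank_eq] at h
  omega

theorem eigenspace_J_four (hk : k ≠ 0) (hv : H.G k x v v ^ 2 = 1) :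
    Module.End.eigenspace (H.J k x v) (H.G k x v v * (4 * k)) =
      LinearMap.range (H.K k x v) ⊓ LinearMap.ker (H.G k x v) := by
  have hε : H.G k x v v ≠ 0 := fun h => by norm_num [h] at hv
  ext y
  rw [Module.End.mem_eigenspace_iff, H.J_eq_four_smul_iff hk hε, Submodule.mem_inf,
    H.mem_range_K_iff hv, LinearMap.mem_ker]

theorem eigenspace_J (hk : k ≠ 0) (hv : H.G k x v v ≠ 0) :
    Module.End.eigenspace (H.J k x v) (H.G k x v v * k) = LinearMap.ker (H.K k x v) := by
  ext y
  rw [Module.End.mem_eigenspace_iff, H.J_eq_smul_iff hk hv, LinearMap.mem_ker]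

theorem ker_K_le (hv : H.G k x v v ≠ 0) :
    LinearMap.ker (H.K k x v) ≤ LinearMap.ker (H.G k x v) := by
  intro y hy
  have := H.G_self_K k x v y
  rw [LinearMap.mem_ker.1 hy, map_zero] at this
  exact (mul_eq_zero.1 this.symm).resolve_left hv

theorem span_sup_range_K (hv : H.G k x v v ^ 2 = 1) :
    Submodule.span ℝ {v} ⊔ LinearMap.range (H.K k x v) ⊓ LinearMap.ker (H.G k x v) =
      LinearMap.range (H.K k x v) := by
  have hmem : v ∈ LinearMap.range (H.K k x v) := (H.mem_range_K_iff hv).2 (H.K_self k x v)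
  refine le_antisymm (sup_le ((Submodule.span_singleton_le_iff_mem _ _).2 hmem) inf_le_left)
    fun y hy => ?_
  refine Submodule.mem_sup.2 ⟨(H.G k x v v * H.G k x v y) • v,
    Submodule.smul_mem _ _ (Submodule.mem_span_singleton_self v),
    y - (H.G k x v v * H.G k x v y) • v, ⟨Submodule.sub_mem _ hy (Submodule.smul_mem _ _ hmem), ?_⟩,
    by abel⟩
  rw [SetLike.mem_coe, LinearMap.mem_ker, map_sub, map_smul, smul_eq_mul]
  linear_combination (-H.G k x v y) * hv

theorem finrank_range_K_inf [FiniteDimensional ℝ V] (hv : H.G k x v v ^ 2 = 1) :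
    Module.finrank ℝ ↥(LinearMap.range (H.K k x v) ⊓ LinearMap.ker (H.G k x v)) = 7 := by
  have hε : H.G k x v v ≠ 0 := fun h => by norm_num [h] at hv
  have hv0 : v ≠ 0 := by
    rintro rfl
    simp at hε
  have h := Submodule.finrank_sup_add_finrank_inf_eq (Submodule.span ℝ {v})
    (LinearMap.range (H.K k x v) ⊓ LinearMap.ker (H.G k x v))
  have h' : Submodule.span ℝ {v} ⊓ (LinearMap.range (H.K k x v) ⊓ LinearMap.ker (H.G k x v)) =
      ⊥ := by
    refine (Submodule.eq_bot_iff _).2 ?_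
    rintro y ⟨hy, -, hy'⟩
    obtain ⟨r, rfl⟩ := Submodule.mem_span_singleton.1 hy
    have : r * H.G k x v v = 0 := by simpa using hy'
    rw [(mul_eq_zero.1 this).resolve_right hε, zero_smul]
  rw [H.span_sup_range_K hv, h', finrank_bot, finrank_span_singleton hv0,
    H.finrank_range_K hv] at h
  omega

theorem range_K_eq_of_mem {w : V} (hv : H.G k x v v ^ 2 = 1) (hw : H.G k x w w ^ 2 = 1)
    (h : w ∈ LinearMap.range (H.K k x v)) :
    LinearMap.range (H.K k x v) = LinearMap.range (H.K k x w) := by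
  have key := H.K_eq_of_mem k x hv ((H.mem_range_K_iff hv).1 h)
  apply le_antisymm
  · rintro _ ⟨y, rfl⟩
    refine ⟨(H.G k x v v * H.G k x w w) • y, ?_⟩
    rw [map_smul, key, smul_smul]
    match_scalars
    linear_combination H.G k x w w ^ 2 * hv + hw
  · rintro _ ⟨y, rfl⟩
    rw [key]
    exact Submodule.smul_mem _ _ ⟨y, rfl⟩

theorem J_restrict [FiniteDimensional ℝ V] (hk : k ≠ 0) (hv : H.G k x v v ^ 2 = 1) :
    ∃ h : ∀ y ∈ LinearMap.ker (H.G k x v), H.J k x v y ∈ LinearMap.ker (H.G k x v),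
      (⨆ c : ℝ, Module.End.eigenspace ((H.J k x v).restrict h) c) = ⊤ ∧
      ∀ c : ℝ, c ≠ 0 → (Module.End.HasEigenvalue ((H.J k x v).restrict h) c ↔
        c = H.G k x v v * (4 * k) ∨ c = H.G k x v v * k) := by
  have hε : H.G k x v v ≠ 0 := fun h => by norm_num [h] at hv
  have mem_iff : ∀ (h : ∀ y ∈ LinearMap.ker (H.G k x v), H.J k x v y ∈ LinearMap.ker (H.G k x v))
      (c : ℝ) (y : LinearMap.ker (H.G k x v)),
      y ∈ Module.End.eigenspace ((H.J k x v).restrict h) c ↔ H.J k x v y = c • (y : V) := by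
    intro h c y
    rw [Module.End.mem_eigenspace_iff, Subtype.ext_iff]
    rfl
  have split₁ : ∀ y ∈ LinearMap.ker (H.G k x v), H.G k x v v • H.K k x v y ∈
      LinearMap.range (H.K k x v) ⊓ LinearMap.ker (H.G k x v) := fun y hy =>
    ⟨Submodule.smul_mem _ _ ⟨y, rfl⟩, by
      rw [SetLike.mem_coe, LinearMap.mem_ker, map_smul, G_self_K, LinearMap.mem_ker.1 hy, mul_zero,
        smul_zero]⟩
  have split₂ : ∀ y, y - H.G k x v v • H.K k x v y ∈ LinearMap.ker (H.K k x v) := fun y => by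
    rw [LinearMap.mem_ker, map_sub, map_smul, K_sq]
    match_scalars
    linear_combination -hv
  have maps : ∀ y ∈ LinearMap.ker (H.G k x v), H.J k x v y ∈ LinearMap.ker (H.G k x v) :=
    fun y _ => H.G_self_J k x v y
  refine ⟨maps, ?_, fun c hc => ⟨fun h => ?_, ?_⟩⟩
  · refine (Submodule.eq_top_iff'.2 ?_)
    rintro ⟨y, hy⟩
    have h₁ := split₁ y hy
    have h₂ := split₂ y
    have h₂' := H.ker_K_le hε h₂
    have e : (⟨y, hy⟩ : LinearMap.ker (H.G k x v)) = ⟨_, h₁.2⟩ + ⟨_, h₂'⟩ :=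
      Subtype.ext (by simp)
    rw [e]
    refine Submodule.add_mem _
      (Submodule.mem_iSup_of_mem (H.G k x v v * (4 * k)) ((mem_iff _ _ _).2 ?_))
      (Submodule.mem_iSup_of_mem (H.G k x v v * k) ((mem_iff _ _ _).2 ?_))
    · rw [← H.eigenspace_J_four hk hv] at h₁
      exact Module.End.mem_eigenspace_iff.1 h₁
    · rw [← H.eigenspace_J hk hε] at h₂
      exact Module.End.mem_eigenspace_iff.1 h₂
  · obtain ⟨⟨y, hy⟩, hy'⟩ := h.exists_hasEigenvector
    have hJ : H.J k x v y = c • y := (mem_iff _ _ _).1 hy'.1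
    by_contra! hne
    have h₀ : H.G k x v y = 0 := hy
    rw [J_apply, h₀] at hJ
    -- Since `(K v)² = ε K v`, applying `K v` shows that `K v y` is zero or `c = 4kε`; in the first
    -- case `J v y = kε y`.
    have hJ' := congrArg (H.K k x v) hJ
    simp only [map_smul, map_sub, map_add, K_sq] at hJ'
    have h₁ : (H.G k x v v * (4 * k) - c) • H.K k x v y = 0 := by
      linear_combination (norm := module) hJ'
    have h₂ := (smul_eq_zero.1 h₁).resolve_left (sub_ne_zero.2 hne.1.symm)
    have h₃ : (H.G k x v v * k - c) • y = 0 := by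
      rw [h₂] at hJ
      linear_combination (norm := module) hJ
    have h₄ := (smul_eq_zero.1 h₃).resolve_left (sub_ne_zero.2 hne.2.symm)
    exact hy'.2 (Subtype.ext h₄)
  -- Only the positivity of the dimensions `7 = 6 + 1` and `8 = 7 + 1` is used, to find an
  -- eigenvector.
  · have exists_of_finrank : ∀ (c : ℝ) (n : ℕ) (L : Submodule ℝ V), L ≤ LinearMap.ker (H.G k x v) →
        (∀ y ∈ L, H.J k x v y = c • y) → Module.finrank ℝ L = n + 1 →
        Module.End.HasEigenvalue ((H.J k x v).restrict maps) c := by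
      intro c n L hL hJ hn
      have : L ≠ ⊥ := by
        rintro rfl
        simp at hn
      obtain ⟨y, hy, hy0⟩ := Submodule.exists_mem_ne_zero_of_ne_bot this
      exact Module.End.hasEigenvalue_of_hasEigenvector (x := ⟨y, hL hy⟩)
        ⟨(mem_iff _ _ _).2 (hJ y hy), fun h => hy0 (congrArg Subtype.val h)⟩
    rintro (rfl | rfl)
    · refine exists_of_finrank _ 6 _ inf_le_right (fun y hy => ?_) (H.finrank_range_K_inf hv)
      rw [← H.eigenspace_J_four hk hv] at hy
      exact Module.End.mem_eigenspace_iff.1 hy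
    · refine exists_of_finrank _ 7 _ (H.ker_K_le hε) (fun y hy => ?_) (H.finrank_ker_K hv)
      rw [← H.eigenspace_J hk hε] at hy
      exact Module.End.mem_eigenspace_iff.1 hy

/-- Since `w` may be null, the description of the eigenspace by `ker (K w)` is not available for
`w`. Instead `K w v = 0` and `G(w, v) = 0` are inserted into the formula for `J w v`. -/
theorem mem_eigenspace_J_symm (hk : k ≠ 0) (hv : H.G k x v v ≠ 0) {w : V}
    (h : w ∈ Module.End.eigenspace (H.J k x v) (H.G k x v v * k)) :
    v ∈ Module.End.eigenspace (H.J k x w) (H.G k x w w * k) := by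
  rw [H.eigenspace_J hk hv] at h
  have h₀ : H.G k x w v = 0 := by
    rw [G_comm]
    exact H.ker_K_le hv h
  rw [Module.End.mem_eigenspace_iff, J_apply, H.K_symm k x hv h, h₀]
  module

end LineTriple

/-! ### Identities in the Cayley algebras -/

namespace CayleyAlgebra

variable {s : ℝ}

/-! ### Inner product and polarized alternative laws -/

theorem ip_eq (x y : CayleyAlgebra s) :
    ip x y = x.1.re * y.1.re + x.1.imI * y.1.imI + x.1.imJ * y.1.imJ + x.1.imK * y.1.imK
      - s * (x.2.re * y.2.re + x.2.imI * y.2.imI + x.2.imJ * y.2.imJ + x.2.imK * y.2.imK) := by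
  simp only [ip, re, mul_fst, star_fst, star_snd]
  simp
  ring

theorem ip_comm (x y : CayleyAlgebra s) : ip x y = ip y x := by
  rw [ip_eq, ip_eq]
  ring

theorem ip_add_left (x y z : CayleyAlgebra s) : ip (x + y) z = ip x z + ip y z := by
  rw [ip, add_mul, re_add, ip, ip]

theorem ip_smul_left (r : ℝ) (x z : CayleyAlgebra s) : ip (r • x) z = r * ip x z := by
  rw [ip, smul_mul_assoc, re_smul, ip]

theorem ip_add_right (x y z : CayleyAlgebra s) : ip x (y + z) = ip x y + ip x z := by
  rw [ip_comm, ip_add_left, ip_comm y, ip_comm z]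

theorem ip_smul_right (r : ℝ) (x z : CayleyAlgebra s) : ip x (r • z) = r * ip x z := by
  rw [ip_comm, ip_smul_left, ip_comm]

theorem normSq_add (x y : CayleyAlgebra s) :
    normSq (x + y) = normSq x + 2 * ip x y + normSq y := by
  simp only [normSq, ip_add_left, ip_add_right, ip_comm y x]
  ring

theorem ip_star_star (x y : CayleyAlgebra s) : ip (star x) (star y) = ip x y := by
  simp [ip_eq]

theorem ip_mul_left (x y z : CayleyAlgebra s) : ip (x * y) z = ip y (star x * z) := by
  simp only [ip_eq, mul_fst, mul_snd, star_fst, star_snd]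
  simp
  ring

theorem ip_mul_right (x y z : CayleyAlgebra s) : ip (x * y) z = ip x (z * star y) := by
  rw [← ip_star_star, star_mul', ip_mul_left, ← ip_star_star, star_mul', star_star', star_star',
    star_star']

/-- Pairing `x` with each of its quaternion components separately gives two sums of squares, the
second with the factor `-s`; the indefinite signature for `s = 1` does no harm. -/
theorem ip_nondeg (hs : s ≠ 0) {x : CayleyAlgebra s} (h : ∀ y, ip x y = 0) : x = 0 := by
  have h₁ := (ip_eq x (x.1, 0)).symm.trans (h _)
  have h₂ := (ip_eq x (0, x.2)).symm.trans (h _)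
  simp only [Quaternion.re_zero, Quaternion.imI_zero, Quaternion.imJ_zero, Quaternion.imK_zero]
    at h₁ h₂
  have h₂' : Quaternion.normSq x.2 = 0 := by
    rw [Quaternion.normSq_def']
    have : s * (x.2.re ^ 2 + x.2.imI ^ 2 + x.2.imJ ^ 2 + x.2.imK ^ 2) = 0 := by
      linear_combination -h₂
    exact (mul_eq_zero.1 this).resolve_left hs
  have h₁' : Quaternion.normSq x.1 = 0 := by
    rw [Quaternion.normSq_def']
    linear_combination h₁
  exact ext' (Quaternion.normSq_eq_zero.1 h₁') (Quaternion.normSq_eq_zero.1 h₂')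

/-- Polarization of `star_mul_mul`. -/
theorem star_mul_mul_add (x y z : CayleyAlgebra s) :
    star x * (y * z) + star y * (x * z) = (2 * ip x y) • z := by
  have h := star_mul_mul (x + y) z
  simp only [star_add', add_mul, mul_add, star_mul_mul, normSq_add] at h
  linear_combination (norm := module) h

theorem mul_star_mul_add (x y z : CayleyAlgebra s) :
    x * (star y * z) + y * (star x * z) = (2 * ip x y) • z := by
  have h := star_mul_mul_add (star x) (star y) z
  rwa [star_star', star_star', ip_star_star] at h

/-- Polarization of `mul_mul_star`. -/
theorem mul_mul_star_add (x y z : CayleyAlgebra s) :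
    z * x * star y + z * y * star x = (2 * ip x y) • z := by
  have h := mul_mul_star (x + y) z
  simp only [star_add', add_mul, mul_add, mul_mul_star, normSq_add] at h
  linear_combination (norm := module) h

theorem mul_star_mul (x y : CayleyAlgebra s) : x * (star x * y) = normSq x • y := by
  have h := star_mul_mul (star x) y
  rwa [star_star', normSq_star] at h

theorem mul_mul_star' (x y : CayleyAlgebra s) : y * star x * x = normSq x • y := by
  have h := mul_mul_star (star x) y
  rwa [star_star', normSq_star] at h

set_option maxHeartbeats 1000000 in
/-- The middle Moufang identity. -/
theorem moufang (x y z : CayleyAlgebra s) : (x * y) * (z * x) = x * (y * z) * x := by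
  apply ext' <;> ext <;> simp <;> ring

/-- Polarization of `moufang`. -/
theorem moufang_add (x y z w : CayleyAlgebra s) :
    (x * y) * (z * w) + (w * y) * (z * x) = x * (y * z) * w + w * (y * z) * x := by
  have h := moufang (x + w) y z
  simp only [add_mul, mul_add, moufang] at h
  linear_combination (norm := module) h

/-- Polarized alternativity moves `r` to the far left in both terms, where `p` and `q` contract. -/
theorem mul_star_mul_mul_add (p q r y : CayleyAlgebra s) :
    p * (star r * (q * y)) + q * (star r * (p * y)) =
      (2 * ip p r) • (q * y) + (2 * ip r q) • (p * y) - (2 * ip p q) • (r * y) := by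
  have h₁ := mul_star_mul_add p r (q * y)
  have h₂ := congrArg (r * ·) (star_mul_mul_add p q y)
  have h₃ := mul_star_mul_add r q (p * y)
  simp only [mul_add, mul_smul_comm] at h₂
  linear_combination (norm := module) h₁ - h₂ + h₃

/-- After multiplication by `y` the right side is that of `mul_star_mul_mul_add`: symmetrizing in
`p` and `q` makes the two bracketings agree. -/
theorem mul_star_mul_left_add (p q r : CayleyAlgebra s) :
    p * star r * q + q * star r * p = (2 * ip p r) • q + (2 * ip r q) • p - (2 * ip p q) • r := by
  have h₁ := mul_mul_star_add (star r) (star q) p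
  have h₂ := mul_mul_star_add (star r) (star p) q
  have h₃ := congrArg (· * r) (mul_mul_star_add p q 1)
  simp only [star_star', ip_star_star, one_mul, add_mul, smul_mul_assoc] at h₁ h₂ h₃
  rw [ip_comm r p] at h₂
  linear_combination (norm := module) h₁ + h₂ - h₃

/-! ### Pairs of octonions or para-octonions as a line triple -/

/-- The bilinear form `⟨a₁, b₁⟩ + ⟨a₂, b₂⟩` on pairs. -/
def pairForm : (CayleyAlgebra s × CayleyAlgebra s) →ₗ[ℝ]
    (CayleyAlgebra s × CayleyAlgebra s) →ₗ[ℝ] ℝ :=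
  LinearMap.mk₂ ℝ (fun a b => ip a.1 b.1 + ip a.2 b.2)
    (fun a b c => by simp only [Prod.fst_add, Prod.snd_add, ip_add_left]; ring)
    (fun r a b => by simp only [Prod.smul_fst, Prod.smul_snd, ip_smul_left, smul_eq_mul]; ring)
    (fun a b c => by simp only [Prod.fst_add, Prod.snd_add, ip_add_right]; ring)
    (fun r a b => by simp only [Prod.smul_fst, Prod.smul_snd, ip_smul_right, smul_eq_mul]; ring)

theorem pairForm_apply (a b : CayleyAlgebra s × CayleyAlgebra s) :
    pairForm a b = ip a.1 b.1 + ip a.2 b.2 := rfl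

/-- The operator with the Hermitian matrix `(α, p; p̄, β)`. -/
def hermOp (α β : ℝ) (p : CayleyAlgebra s) :
    (CayleyAlgebra s × CayleyAlgebra s) →ₗ[ℝ] (CayleyAlgebra s × CayleyAlgebra s) where
  toFun x := (α • x.1 + p * x.2, β • x.2 + star p * x.1)
  map_add' x y := by
    ext1 <;> simp only [Prod.fst_add, Prod.snd_add, mul_add] <;> module
  map_smul' r x := by
    ext1 <;> simp only [Prod.smul_fst, Prod.smul_snd, mul_smul_comm, RingHom.id_apply] <;> module

theorem hermOp_apply (α β : ℝ) (p : CayleyAlgebra s) (x : CayleyAlgebra s × CayleyAlgebra s) :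
    hermOp α β p x = (α • x.1 + p * x.2, β • x.2 + star p * x.1) := rfl

theorem hermOp_add (α β α' β' : ℝ) (p p' : CayleyAlgebra s) :
    hermOp (α + α') (β + β') (p + p') = hermOp α β p + hermOp α' β' p' := by
  refine LinearMap.ext fun x => Prod.ext ?_ ?_ <;>
    simp only [hermOp_apply, star_add', add_mul, LinearMap.add_apply, Prod.fst_add, Prod.snd_add]
      <;> module

theorem hermOp_smul (r α β : ℝ) (p : CayleyAlgebra s) :
    hermOp (r * α) (r * β) (r • p) = r • hermOp α β p := by
  refine LinearMap.ext fun x => Prod.ext ?_ ?_ <;>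
    simp only [hermOp_apply, star_smul', smul_mul_assoc, LinearMap.smul_apply, Prod.smul_fst,
      Prod.smul_snd] <;> module

/-- The polarization of `2 a ā`, acting on pairs. -/
def pairOp : (CayleyAlgebra s × CayleyAlgebra s) →ₗ[ℝ] (CayleyAlgebra s × CayleyAlgebra s) →ₗ[ℝ]
    (CayleyAlgebra s × CayleyAlgebra s) →ₗ[ℝ] (CayleyAlgebra s × CayleyAlgebra s) :=
  LinearMap.mk₂ ℝ (fun a b => hermOp (2 * ip a.1 b.1) (2 * ip a.2 b.2)
      (a.1 * star b.2 + b.1 * star a.2))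
    (fun a b c => by
      rw [← hermOp_add]
      congr 1
      · simp only [Prod.fst_add, ip_add_left]; ring
      · simp only [Prod.snd_add, ip_add_left]; ring
      · simp only [Prod.fst_add, Prod.snd_add, star_add', add_mul, mul_add]; abel)
    (fun r a b => by
      rw [← hermOp_smul]
      congr 1
      · simp only [Prod.smul_fst, ip_smul_left]; ring
      · simp only [Prod.smul_snd, ip_smul_left]; ring
      · simp only [Prod.smul_fst, Prod.smul_snd, star_smul', smul_mul_assoc, mul_smul_comm,
          smul_add])
    (fun a b c => by
      rw [← hermOp_add]
      congr 1
      · simp only [Prod.fst_add, ip_add_right]; ring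
      · simp only [Prod.snd_add, ip_add_right]; ring
      · simp only [Prod.fst_add, Prod.snd_add, star_add', add_mul, mul_add]; abel)
    (fun r a b => by
      rw [← hermOp_smul]
      congr 1
      · simp only [Prod.smul_fst, ip_smul_right]; ring
      · simp only [Prod.smul_snd, ip_smul_right]; ring
      · simp only [Prod.smul_fst, Prod.smul_snd, star_smul', smul_mul_assoc, mul_smul_comm,
          smul_add])

theorem pairOp_eq (a b : CayleyAlgebra s × CayleyAlgebra s) :
    pairOp a b = hermOp (2 * ip a.1 b.1) (2 * ip a.2 b.2) (a.1 * star b.2 + b.1 * star a.2) := rfl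

theorem pairOp_fst (a b x : CayleyAlgebra s × CayleyAlgebra s) :
    (pairOp a b x).1 = (2 * ip a.1 b.1) • x.1 + (a.1 * star b.2 + b.1 * star a.2) * x.2 := rfl

theorem pairOp_snd (a b x : CayleyAlgebra s × CayleyAlgebra s) :
    (pairOp a b x).2 = (2 * ip a.2 b.2) • x.2 + (a.2 * star b.1 + b.2 * star a.1) * x.1 := by
  rw [pairOp_eq, hermOp_apply, star_add', star_mul', star_mul', star_star', star_star', add_comm
    (b.2 * _)]

/-- Exchanging the two coordinates preserves all the structure, so the later vector identities are
verified in the first coordinate only. -/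
theorem pairOp_swap (a b x : CayleyAlgebra s × CayleyAlgebra s) :
    pairOp a.swap b.swap x.swap = (pairOp a b x).swap :=
  Prod.ext (pairOp_snd a b x).symm (pairOp_snd a.swap b.swap x.swap)

theorem pairForm_swap (a b : CayleyAlgebra s × CayleyAlgebra s) :
    pairForm a.swap b.swap = pairForm a b := add_comm _ _

theorem pairOp_comm (a b x : CayleyAlgebra s × CayleyAlgebra s) : pairOp a b x = pairOp b a x := by
  rw [pairOp_eq, pairOp_eq, ip_comm, ip_comm a.2, add_comm]

/-- `pairOp a a = 2 lineOp a`. -/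
def lineOp (a : CayleyAlgebra s × CayleyAlgebra s) :
    (CayleyAlgebra s × CayleyAlgebra s) →ₗ[ℝ] (CayleyAlgebra s × CayleyAlgebra s) :=
  hermOp (normSq a.1) (normSq a.2) (a.1 * star a.2)

theorem pairOp_self (a : CayleyAlgebra s × CayleyAlgebra s) : pairOp a a = (2 : ℝ) • lineOp a := by
  rw [pairOp_eq, lineOp, ← hermOp_smul, two_smul ℝ (a.1 * star a.2)]
  rfl

theorem lineOp_fst (a x : CayleyAlgebra s × CayleyAlgebra s) :
    (lineOp a x).1 = normSq a.1 • x.1 + a.1 * star a.2 * x.2 := rfl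

theorem lineOp_snd (a x : CayleyAlgebra s × CayleyAlgebra s) :
    (lineOp a x).2 = normSq a.2 • x.2 + a.2 * star a.1 * x.1 := by
  rw [lineOp, hermOp_apply, star_mul', star_star']

theorem lineOp_swap (a x : CayleyAlgebra s × CayleyAlgebra s) :
    lineOp a.swap x.swap = (lineOp a x).swap :=
  Prod.ext (lineOp_snd a x).symm (lineOp_snd a.swap x.swap)

/-- The equations of the image of `lineOp a`. -/
def OnLine (a z : CayleyAlgebra s × CayleyAlgebra s) : Prop :=
  a.2 * star a.1 * z.1 = normSq a.1 • z.2 ∧ a.1 * star a.2 * z.2 = normSq a.2 • z.1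

theorem OnLine.swap {a z : CayleyAlgebra s × CayleyAlgebra s} (h : OnLine a z) :
    OnLine a.swap z.swap := ⟨h.2, h.1⟩

theorem onLine_self (a : CayleyAlgebra s × CayleyAlgebra s) : OnLine a a :=
  ⟨mul_mul_star' _ _, mul_mul_star' _ _⟩

theorem onLine_lineOp (a y : CayleyAlgebra s × CayleyAlgebra s) : OnLine a (lineOp a y) := by
  have h : ∀ a y : CayleyAlgebra s × CayleyAlgebra s,
      a.1 * star a.2 * (lineOp a y).2 = normSq a.2 • (lineOp a y).1 := fun a y => by
    rw [lineOp_fst, lineOp_snd]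
    have e := mul_star_mul (a.1 * star a.2) y.1
    rw [star_mul', star_star', normSq_mul, normSq_star] at e
    rw [mul_add, e, mul_smul_comm]
    module
  refine ⟨?_, h a y⟩
  have := h a.swap y.swap
  rw [lineOp_swap] at this
  exact this

theorem pairForm_lineOp_self (x v : CayleyAlgebra s × CayleyAlgebra s) :
    pairForm (lineOp x v) v = normSq x.1 * normSq v.1 + normSq x.2 * normSq v.2
      + 2 * ip (x.1 * star x.2) (v.1 * star v.2) := by
  have h : ip (x.2 * star x.1 * v.1) v.2 = ip (x.1 * star x.2) (v.1 * star v.2) := by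
    rw [← ip_star_star (x.1 * star x.2), star_mul', star_mul', star_star', star_star',
      ip_mul_right]
  rw [pairForm_apply, lineOp_fst, lineOp_snd, ip_add_left, ip_add_left, ip_smul_left,
    ip_smul_left, ip_mul_right (x.1 * star x.2), ← ip_star_star _ (v.1 * _)]
  simp only [normSq] at *
  rw [h, ip_star_star]
  ring

/-- Stated for every `z` on the line of `v`, to cover both `z = v` (`T_T_self`) and `z = lineOp v y`
(`T_T_T`). The line equations exchange `z.1` and `z.2`; then polarized alternativity contracts the
off-diagonal entries of the two matrices. -/
theorem lineOp_lineOp_of_onLine {v z : CayleyAlgebra s × CayleyAlgebra s} (h : OnLine v z)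
    (x : CayleyAlgebra s × CayleyAlgebra s) :
    lineOp v (lineOp x z) = pairForm (lineOp x v) v • z := by
  have key : ∀ {v z : CayleyAlgebra s × CayleyAlgebra s} (_ : OnLine v z)
      (x : CayleyAlgebra s × CayleyAlgebra s),
      (lineOp v (lineOp x z)).1 = pairForm (lineOp x v) v • z.1 := by
    intro v z h x
    have e := mul_star_mul_add (v.1 * star v.2) (x.1 * star x.2) z.1
    have e' : normSq v.1 • (x.1 * star x.2 * z.2) = x.1 * star x.2 * (v.2 * star v.1 * z.1) := by
      rw [h.1, mul_smul_comm]
    have e'' := congrArg (normSq x.2 • ·) h.2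
    rw [pairForm_lineOp_self, lineOp_fst, lineOp_fst, lineOp_snd]
    simp only [star_mul', star_star'] at e
    rw [ip_comm] at e
    simp only [mul_add, smul_add, mul_smul_comm, e']
    linear_combination (norm := module) e + e''
  refine Prod.ext (key h x) ?_
  have := key h.swap x.swap
  rwa [lineOp_swap, lineOp_swap, lineOp_swap, pairForm_swap] at this

/-- Products with a repeated factor collapse by alternativity, and the remaining off-diagonal terms
are one instance of its polarization. -/
theorem pairOp_lineOp (v x y : CayleyAlgebra s × CayleyAlgebra s) :
    pairOp v (lineOp x v) y = lineOp x (lineOp v y) + lineOp v (lineOp x y) := by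
  have key : ∀ v x y : CayleyAlgebra s × CayleyAlgebra s,
      (pairOp v (lineOp x v) y).1 = (lineOp x (lineOp v y)).1 + (lineOp v (lineOp x y)).1 := by
    intro v x y
    have e := mul_star_mul_add (v.1 * star v.2) (x.1 * star x.2) y.1
    have e₁ : ip v.1 (x.1 * star x.2 * v.2) = ip (v.1 * star v.2) (x.1 * star x.2) := by
      rw [ip_mul_right v.1, star_star', ip_comm, ip_mul_right, ip_comm, ip_mul_right, star_star']
    have e₂ := mul_star_mul v.1 (x.1 * star x.2)
    have e₃ := mul_mul_star v.2 (x.1 * star x.2)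
    simp only [star_mul', star_star'] at e
    simp only [pairOp_fst, lineOp_fst, lineOp_snd, ip_add_right, ip_smul_right, star_add',
      star_smul', star_mul', star_star', mul_add, add_mul, mul_smul_comm, smul_mul_assoc, e₁, e₂,
      e₃, smul_add]
    simp only [normSq] at *
    linear_combination (norm := module) -e
  refine Prod.ext (key v x y) ?_
  have := key v.swap x.swap y.swap
  simp only [lineOp_swap, pairOp_swap] at this
  exact this

/-- The computation works for arbitrary Hermitian matrices. The products `(p w₂)(w̄₁ q)` have all
four factors grouped the wrong way; the polarized Moufang identity `m₁` regroups them around `w₂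
w̄₁`, and `m₂ - m₃` shifts the outer bracket to reach `y.2`. -/
theorem pairOp_hermOp_hermOp_fst (α β α' β' : ℝ) (p q : CayleyAlgebra s)
    (w y : CayleyAlgebra s × CayleyAlgebra s) :
    (pairOp (hermOp α β p w) (hermOp α' β' q w) y).1 =
      (hermOp α β p (lineOp w (hermOp α' β' q y))).1
        + (hermOp α' β' q (lineOp w (hermOp α β p y))).1 := by
  have e₁ : ip w.1 (q * w.2) = ip (w.1 * star w.2) q := by
    rw [ip_comm, ip_mul_right, ip_comm]
  have e₂ : ip (p * w.2) w.1 = ip (w.1 * star w.2) p := by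
    rw [ip_mul_right, ip_comm]
  have e₃ : ip (p * w.2) (q * w.2) = normSq w.2 * ip p q := by
    rw [ip_mul_right, mul_mul_star, ip_smul_right]
  have e₄ := mul_star_mul w.1 q
  have e₅ := mul_star_mul w.1 p
  have e₆ := mul_mul_star w.2 q
  have e₇ := mul_mul_star w.2 p
  have m₁ := congrArg (· * y.2) (moufang_add p w.2 (star w.1) q)
  have m₂ := congrArg (· * y.2) (mul_star_mul_left_add p q (w.1 * star w.2))
  have m₃ := mul_star_mul_mul_add p q (w.1 * star w.2) y.2
  have c₁ := mul_star_mul_add (w.1 * star w.2) q y.1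
  have c₂ := mul_star_mul_add (w.1 * star w.2) p y.1
  have c₃ := mul_star_mul_add p q y.1
  simp only [star_mul', star_star', add_mul, sub_mul, smul_mul_assoc] at m₁ m₂ m₃ c₁ c₂
  simp only [pairOp_fst, hermOp_apply, lineOp_fst, lineOp_snd, ip_add_left, ip_add_right,
    ip_smul_left, ip_smul_right, star_add', star_smul', star_mul', star_star', mul_add, add_mul,
    mul_smul_comm, smul_mul_assoc, smul_add, e₁, e₂, e₃, e₄, e₅, e₆, e₇]
  simp only [normSq] at *
  linear_combination (norm := module) m₁ + m₂ - m₃ - α • c₁ - α' • c₂ - ip w.2 w.2 • c₃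

theorem pairOp_lineOp_lineOp (x v w y : CayleyAlgebra s × CayleyAlgebra s) :
    pairOp (lineOp x w) (lineOp v w) y =
      lineOp x (lineOp w (lineOp v y)) + lineOp v (lineOp w (lineOp x y)) := by
  have key : ∀ x v w y : CayleyAlgebra s × CayleyAlgebra s,
      (pairOp (lineOp x w) (lineOp v w) y).1 =
        (lineOp x (lineOp w (lineOp v y))).1 + (lineOp v (lineOp w (lineOp x y))).1 :=
     fun x v w y => pairOp_hermOp_hermOp_fst _ _ _ _ _ _ w y
  refine Prod.ext (key x v w y) ?_
  have := key x.swap v.swap w.swap y.swap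
  simp only [lineOp_swap, pairOp_swap] at this
  exact this

theorem pairOp_symm (a b x y : CayleyAlgebra s × CayleyAlgebra s) :
    pairForm (pairOp a b x) y = pairForm x (pairOp a b y) := by
  simp only [pairOp_eq, hermOp_apply, pairForm_apply, ip_add_left, ip_add_right, ip_smul_left,
    ip_smul_right, ip_mul_left _ x.1, ip_mul_left _ x.2, star_star']
  ring

theorem pairOp_pairForm_swap (a b x y : CayleyAlgebra s × CayleyAlgebra s) :
    pairForm (pairOp a b x) y = pairForm (pairOp x y a) b := by
  have h : ∀ p q r t : CayleyAlgebra s, ip (p * star q * r) t = ip (t * star r * q) p := by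
    intro p q r t
    rw [ip_mul_right, ip_mul_right, ip_comm, star_star']
  have h' : ∀ p q r t : CayleyAlgebra s, ip (p * star q * r) t = ip (r * star t * p) q := by
    intro p q r t
    rw [h, ip_mul_right (t * star r), ← ip_star_star, star_mul', star_star', star_mul',
      star_star', ← ip_mul_right]
  simp only [pairForm_apply, pairOp_fst, pairOp_snd, add_mul, ip_add_left, ip_smul_left]
  rw [h' a.1 b.2 x.2 y.1, h b.1 a.2 x.2 y.1, h' a.2 b.1 x.1 y.2, h b.2 a.1 x.1 y.2]
  ring

theorem pairOp_cyc (a b c : CayleyAlgebra s × CayleyAlgebra s) :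
    pairOp a b c + pairOp b c a + pairOp c a b =
      (2 : ℝ) • (pairForm a b • c + pairForm b c • a + pairForm c a • b) := by
  have key : ∀ a b c : CayleyAlgebra s × CayleyAlgebra s,
      (pairOp a b c).1 + (pairOp b c a).1 + (pairOp c a b).1 =
        (2 : ℝ) • (pairForm a b • c.1 + pairForm b c • a.1 + pairForm c a • b.1) := by
    intro a b c
    have h₁ := mul_mul_star_add (star b.2) (star c.2) a.1
    have h₂ := mul_mul_star_add (star c.2) (star a.2) b.1
    have h₃ := mul_mul_star_add (star a.2) (star b.2) c.1
    simp only [star_star', ip_star_star] at h₁ h₂ h₃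
    simp only [pairForm_apply, pairOp_fst, add_mul]
    linear_combination (norm := module) h₁ + h₂ + h₃
  refine Prod.ext (key a b c) ?_
  have := key a.swap b.swap c.swap
  simp only [pairOp_swap, pairForm_swap] at this
  exact this

theorem finrank_cayleyAlgebra : Module.finrank ℝ (CayleyAlgebra s) = 8 := by
  have : Module.finrank ℝ (ℍ[ℝ] × ℍ[ℝ]) = 8 := by
    rw [Module.finrank_prod, Quaternion.finrank_eq_four]
  exact this

/-- By cyclicity of the trace the off-diagonal blocks contribute nothing, and the diagonal ones are
scalars on an 8-dimensional space. -/
theorem trace_hermOp (α β : ℝ) (p : CayleyAlgebra s) :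
    LinearMap.trace ℝ _ (hermOp α β p) = 8 * (α + β) := by
  have h : hermOp α β p =
      α • LinearMap.inl ℝ _ _ ∘ₗ LinearMap.fst ℝ (CayleyAlgebra s) (CayleyAlgebra s)
      + β • LinearMap.inr ℝ _ _ ∘ₗ LinearMap.snd ℝ (CayleyAlgebra s) (CayleyAlgebra s)
      + LinearMap.inl ℝ _ _ ∘ₗ LinearMap.mul ℝ _ p ∘ₗ LinearMap.snd ℝ _ _
      + LinearMap.inr ℝ _ _ ∘ₗ LinearMap.mul ℝ _ (star p) ∘ₗ LinearMap.fst ℝ _ _ := by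
    refine LinearMap.ext fun x => Prod.ext ?_ ?_ <;> simp [hermOp_apply]
  have h₁ : LinearMap.fst ℝ (CayleyAlgebra s) (CayleyAlgebra s) ∘ₗ LinearMap.inl ℝ _ _ =
    LinearMap.id := rfl
  have h₂ : LinearMap.snd ℝ (CayleyAlgebra s) (CayleyAlgebra s) ∘ₗ LinearMap.inr ℝ _ _ =
    LinearMap.id := rfl
  have h₃ : LinearMap.fst ℝ (CayleyAlgebra s) (CayleyAlgebra s) ∘ₗ LinearMap.inr ℝ _ _ = 0 := rfl
  have h₄ : LinearMap.snd ℝ (CayleyAlgebra s) (CayleyAlgebra s) ∘ₗ LinearMap.inl ℝ _ _ = 0 := rfl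
  have t₁ : ∀ f : (CayleyAlgebra s × CayleyAlgebra s) →ₗ[ℝ] CayleyAlgebra s,
      LinearMap.trace ℝ _ (LinearMap.inl ℝ _ _ ∘ₗ f) =
        LinearMap.trace ℝ _ (f ∘ₗ LinearMap.inl ℝ _ _) :=
    fun f => LinearMap.trace_comp_comm' f _
  have t₂ : ∀ f : (CayleyAlgebra s × CayleyAlgebra s) →ₗ[ℝ] CayleyAlgebra s,
      LinearMap.trace ℝ _ (LinearMap.inr ℝ _ _ ∘ₗ f) =
        LinearMap.trace ℝ _ (f ∘ₗ LinearMap.inr ℝ _ _) :=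
    fun f => LinearMap.trace_comp_comm' f _
  rw [h, map_add, map_add, map_add, map_smul, map_smul, t₁, t₂, t₁, t₂, LinearMap.comp_assoc,
    LinearMap.comp_assoc,
    h₁, h₂, h₃, h₄, LinearMap.comp_zero, LinearMap.comp_zero, map_zero, LinearMap.trace_id,
    finrank_cayleyAlgebra]
  simp
  ring

/-- The line triple of pairs of octonions or para-octonions. -/
def pairTriple (hs : s ≠ 0) : LineTriple (CayleyAlgebra s × CayleyAlgebra s) where
  B := pairForm
  T := pairOp
  B_comm a b := by rw [pairForm_apply, pairForm_apply, ip_comm, ip_comm a.2]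
  B_nondeg a h := Prod.ext
    (ip_nondeg hs fun y => by
      have := h (y, 0)
      simpa [pairForm_apply, ip_eq a.2] using this)
    (ip_nondeg hs fun y => by
      have := h (0, y)
      simpa [pairForm_apply, ip_eq a.1] using this)
  T_comm := pairOp_comm
  T_symm := pairOp_symm
  T_swap := pairOp_pairForm_swap
  T_cyc := pairOp_cyc
  T_T_self v x := by
    simp only [pairOp_self, LinearMap.smul_apply, map_smul,
      lineOp_lineOp_of_onLine (onLine_self v) x, smul_eq_mul]
    module
  T_mul v x y := by
    simp only [pairOp_self, LinearMap.smul_apply, map_smul, pairOp_lineOp]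
    module
  T_T_T v x y := by
    simp only [pairOp_self, LinearMap.smul_apply, map_smul,
      lineOp_lineOp_of_onLine (onLine_lineOp v y) x, smul_eq_mul]
    module
  T_image x v w y := by
    simp only [pairOp_self, LinearMap.smul_apply, map_smul, pairOp_lineOp_lineOp]
    module
  finrank_eq := by rw [Module.finrank_prod, finrank_cayleyAlgebra]
  trace_T a b := by
    rw [pairOp_eq, trace_hermOp, pairForm_apply]
    ring

end CayleyAlgebra

/-! ### Curvature of the metric of a line triple -/

section Calculus

variable {V W : Type*} [NormedAddCommGroup V] [NormedSpace ℝ V]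
  [NormedAddCommGroup W] [NormedSpace ℝ W]

/-! ### Calculus of quadratic maps and raising an index -/

theorem LinearMap.hasLineDerivAt_diag (β : V →ₗ[ℝ] V →ₗ[ℝ] ℝ) (x u : V) :
    HasLineDerivAt ℝ (fun y => β y y) (β x u + β u x) x u := by
  have h : (fun t : ℝ => β (x + t • u) (x + t • u)) =
      fun t => β x x + t * (β x u + β u x) + t ^ 2 * β u u := by
    ext t
    simp only [map_add, map_smul, LinearMap.add_apply, LinearMap.smul_apply, smul_eq_mul]
    ring
  rw [HasLineDerivAt, h]
  have := (((hasDerivAt_id (0 : ℝ)).mul_const (β x u + β u x)).const_add (β x x)).fun_add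
    (((hasDerivAt_id (0 : ℝ)).pow 2).mul_const (β u u))
  simpa using this

variable [FiniteDimensional ℝ V]

theorem LinearMap.contDiff_diag (β : V →ₗ[ℝ] V →ₗ[ℝ] W) {n : WithTop ℕ∞} :
    ContDiff ℝ n fun y => β y y :=
  β.toContinuousBilinearMap.isBoundedBilinearMap.contDiff.comp (contDiff_id.prodMk contDiff_id)

/-- `inverse` is meaningful only for invertible maps; an injective map from `V` to its dual is
invertible because the dimensions agree. -/
theorem ContinuousLinearMap.inverse_apply_of_injective {g : V →L[ℝ] V →L[ℝ] ℝ}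
    (hg : ∀ v, (∀ w, g v w = 0) → v = 0) (z : V) : g.inverse (g z) = z := by
  have hr : Module.finrank ℝ V = Module.finrank ℝ (V →L[ℝ] ℝ) := by
    rw [← (LinearMap.toContinuousLinearMap (𝕜 := ℝ) (E := V) (F' := ℝ)).finrank_eq]
    exact Subspace.dual_finrank_eq.symm
  have hi : Function.Injective (g : V →ₗ[ℝ] V →L[ℝ] ℝ) := by
    refine (injective_iff_map_eq_zero _).2 fun v hv => hg v fun w => ?_
    exact congrArg (fun L : V →L[ℝ] ℝ => L w) hv
  let e := (LinearEquiv.ofInjectiveOfFinrankEq _ hi hr).toContinuousLinearEquiv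
  have he : g = (e : V →L[ℝ] V →L[ℝ] ℝ) := by
    ext v : 1
    rfl
  rw [he, ContinuousLinearMap.inverse_equiv]
  exact e.symm_apply_apply z

end Calculus

namespace LineTriple

open Filter Topology

variable {V : Type*} [NormedAddCommGroup V] [NormedSpace ℝ V] [FiniteDimensional ℝ V]
  (H : LineTriple V) (k : ℝ) {x : V}

/-! ### Connection and curvature of the metric -/

theorem contDiff_N {n : WithTop ℕ∞} : ContDiff ℝ n (H.N k) :=
  contDiff_const.add (contDiff_const.mul H.B.contDiff_diag)

theorem contDiffAt_G (hN : H.N k x ≠ 0) (v w : V) {n : WithTop ℕ∞} :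
    ContDiffAt ℝ n (fun y => H.G k y v w) x := by
  simp only [G_eq_diag]
  exact (((H.contDiff_N k).mul contDiff_const).sub
    (contDiff_const.mul (LinearMap.contDiff_diag _))).contDiffAt.div
    ((H.contDiff_N k).pow 2).contDiffAt (pow_ne_zero 2 hN)

/-- By `G_eq_diag`, for fixed `v` and `w` the metric is a rational function of two quadratic forms
in the point. `T_swap` brings their derivatives back to the form `B(T x u v, w)`. -/
theorem fderiv_G (hN : H.N k x ≠ 0) (u v w : V) :
    fderiv ℝ (fun y => H.G k y v w) x u =
      (2 * k * H.B x u * H.B v w - k * H.B (H.T x u v) w) / H.N k x ^ 2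
      - 4 * k * H.B x u * (H.N k x * H.B v w - k / 2 * H.B (H.T x x v) w) / H.N k x ^ 3 := by
  have h₁ := LinearMap.hasLineDerivAt_diag H.B x u
  have h₂ := LinearMap.hasLineDerivAt_diag (H.B.comp (H.T v w)) x u
  have h₃ : HasDerivAt (fun t : ℝ => H.N k (x + t • u)) (k * (H.B x u + H.B u x)) 0 :=
    (h₁.const_mul k).const_add 1
  have h₄ := ((h₃.mul_const (H.B v w)).fun_sub (HasDerivAt.const_mul (k / 2) h₂)).fun_div
    (h₃.fun_pow 2) (by simpa using hN)
  have e₁ : H.B (H.T v w x) u = H.B (H.T x u v) w := H.T_swap v w x u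
  have e₂ : H.B (H.T v w u) x = H.B (H.T x u v) w := by rw [H.T_symm, H.B_comm, e₁]
  have e₃ : H.B (H.T v w x) x = H.B (H.T x x v) w := H.B_T_T v w x
  have h₅ : HasLineDerivAt ℝ (fun y => H.G k y v w)
      ((2 * k * H.B x u * H.B v w - k * H.B (H.T x u v) w) / H.N k x ^ 2
      - 4 * k * H.B x u * (H.N k x * H.B v w - k / 2 * H.B (H.T x x v) w) / H.N k x ^ 3) x u := by
    simp only [G_eq_diag]
    refine HasDerivAt.congr_deriv h₄ ?_
    simp only [zero_smul, add_zero, LinearMap.comp_apply, H.B_comm u x, e₁, e₂, e₃]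
    field_simp
    ring
  rw [← ((H.contDiffAt_G k hN v w (n := 1)).differentiableAt one_ne_zero).lineDeriv_eq_fderiv,
    h₅.lineDeriv]

theorem contDiffAt_metric {G : V → V →L[ℝ] V →L[ℝ] ℝ}
    (hG : ∀ᶠ y in 𝓝 x, ∀ a b, G y a b = H.G k y a b) (hN : H.N k x ≠ 0) :
    ContDiffAt ℝ ∞ G x := by
  have hN' : ∀ᶠ y in 𝓝 x, H.N k y ≠ 0 :=
    (H.contDiff_N k (n := 0)).continuous.continuousAt.eventually_ne hN
  obtain ⟨U, hU, hUo, hxU⟩ := eventually_nhds_iff.1 (hG.and hN')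
  have h : ContDiffOn ℝ ∞ G U := by
    refine contDiffOn_clm_apply.2 fun a => contDiffOn_clm_apply.2 fun b => ?_
    have h' : ContDiffOn ℝ ∞ (fun y => H.G k y a b) U := fun y hy =>
      (H.contDiffAt_G k (hU y hy).2 a b).contDiffWithinAt
    exact h'.congr fun y hy => (hU y hy).1 a b
  exact h.contDiffAt (hUo.mem_nhds hxU)

theorem fderiv_metric {G : V → V →L[ℝ] V →L[ℝ] ℝ}
    (hG : ∀ᶠ y in 𝓝 x, ∀ a b, G y a b = H.G k y a b) (hN : H.N k x ≠ 0) (u v w : V) :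
    fderiv ℝ G x u v w = fderiv ℝ (fun y => H.G k y v w) x u := by
  have hd : DifferentiableAt ℝ G x :=
    (H.contDiffAt_metric k hG hN).differentiableAt (by simp)
  have h : (fun y => H.G k y v w) =ᶠ[𝓝 x] fun y => G y v w := hG.mono fun y h => (h v w).symm
  rw [h.fderiv_eq, fderiv_clm_apply (hd.clm_apply (differentiableAt_const v))
    (differentiableAt_const w), fderiv_clm_apply hd (differentiableAt_const v)]
  simp

theorem christoffelLower_metric {G : V → V →L[ℝ] V →L[ℝ] ℝ}
    (hG : ∀ᶠ y in 𝓝 x, ∀ a b, G y a b = H.G k y a b) (hN : H.N k x ≠ 0) (a b c : V) :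
    christoffelLower G x a b c = H.G k x (-(k / H.N k x) • H.D x a b) c := by
  have e : H.B b a = H.B a b := H.B_comm b a
  have e₁ : H.B (H.T x x b) a = H.B (H.T x x a) b := by rw [H.T_symm, H.B_comm]
  rw [christoffelLower_apply, H.fderiv_metric k hG hN, H.fderiv_metric k hG hN,
    H.fderiv_metric k hG hN, H.fderiv_G k hN, H.fderiv_G k hN, H.fderiv_G k hN, H.G_D k x a b c hN]
  field_simp
  ring

theorem christoffel_metric {G : V → V →L[ℝ] V →L[ℝ] ℝ}
    (hG : ∀ᶠ y in 𝓝 x, ∀ a b, G y a b = H.G k y a b) (hN : H.N k x ≠ 0) (a b : V) :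
    christoffel G x a b = -(k / H.N k x) • H.D x a b := by
  have hx := hG.self_of_nhds
  have h : christoffelLower G x a b = G x (-(k / H.N k x) • H.D x a b) := by
    ext c
    rw [hx, H.christoffelLower_metric k hG hN]
  rw [christoffel_apply, h]
  exact ContinuousLinearMap.inverse_apply_of_injective
    (fun v hv => H.G_nondeg k x hN fun w => (hx v w).symm.trans (hv w)) _

/-- Product rule: `D` is linear in the point, and the second term comes from the derivative of
`-k/N`. The formula for `christoffel G` is needed on a neighbourhood of `x`, not only at `x`. -/
theorem fderiv_christoffel_metric {G : V → V →L[ℝ] V →L[ℝ] ℝ}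
    (hG : ∀ᶠ y in 𝓝 x, ∀ a b, G y a b = H.G k y a b) (hN : H.N k x ≠ 0) (u a b : V) :
    fderiv ℝ (christoffel G) x u a b =
      -(k / H.N k x) • H.D u a b + (2 * k ^ 2 * H.B x u / H.N k x ^ 2) • H.D x a b := by
  let L : (V →ₗ[ℝ] V →ₗ[ℝ] V) →ₗ[ℝ] V →L[ℝ] V →L[ℝ] V :=
    { toFun := LinearMap.toContinuousBilinearMap
      map_add' := fun _ _ => rfl
      map_smul' := fun _ _ => rfl }
  let D' : V →L[ℝ] V →L[ℝ] V →L[ℝ] V := LinearMap.toContinuousLinearMap (L ∘ₗ H.D)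
  have hD' : ∀ y a b, D' y a b = H.D y a b := fun _ _ _ => rfl
  have hc : ContDiffAt ℝ 1 (fun y => -(k / H.N k y)) x :=
    (contDiffAt_const.div (H.contDiff_N k).contDiffAt hN).neg
  have hcd := hc.differentiableAt one_ne_zero
  have hev : christoffel G =ᶠ[𝓝 x] fun y => (-(k / H.N k y)) • D' y := by
    have hN' : ∀ᶠ y in 𝓝 x, H.N k y ≠ 0 :=
      (H.contDiff_N k (n := 0)).continuous.continuousAt.eventually_ne hN
    filter_upwards [hG.eventually_nhds, hN'] with y hy hNy
    ext a b
    rw [H.christoffel_metric k hy hNy]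
    rfl
  have hl : HasLineDerivAt ℝ (fun y => -(k / H.N k y)) (2 * k ^ 2 * H.B x u / H.N k x ^ 2) x u := by
    have h₁ := LinearMap.hasLineDerivAt_diag H.B x u
    have h₃ : HasDerivAt (fun t : ℝ => H.N k (x + t • u)) (k * (H.B x u + H.B u x)) 0 :=
      (h₁.const_mul k).const_add 1
    have h₄ := ((hasDerivAt_const (0 : ℝ) k).fun_div h₃ (by simpa using hN)).fun_neg
    refine HasDerivAt.congr_deriv h₄ ?_
    rw [zero_smul, add_zero, H.B_comm u x]
    ring
  rw [hev.fderiv_eq, fderiv_fun_smul hcd D'.differentiableAt, D'.fderiv]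
  simp only [add_apply, smul_apply, ContinuousLinearMap.smulRight_apply, hD']
  rw [← hcd.lineDeriv_eq_fderiv, hl.lineDeriv]

theorem jacobiLocal_metric {G : V → V →L[ℝ] V →L[ℝ] ℝ}
    (hG : ∀ᶠ y in 𝓝 x, ∀ a b, G y a b = H.G k y a b) (hN : H.N k x ≠ 0) (v : V) :
    jacobiLocal G x v = H.J k x v := by
  ext y
  change curvature G x v y v = _
  simp only [curvature, H.fderiv_christoffel_metric k hG hN, H.christoffel_metric k hG hN, map_smul]
  rw [H.J_eq k x hN]
  simp only [smul_sub, smul_add, smul_smul]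
  module

end LineTriple

namespace LineTriple

variable {V : Type*} [NormedAddCommGroup V] [NormedSpace ℝ V] [FiniteDimensional ℝ V]
  (H : LineTriple V) {k : ℝ} {M : Type*} [TopologicalSpace M] [ChartedSpace V M]
  {g : ∀ p : M, TangentSpace 𝓘(ℝ, V) p →L[ℝ] TangentSpace 𝓘(ℝ, V) p →L[ℝ] ℝ}

/-- A manifold whose metric is that of a line triple in all charts is special Osserman. -/
theorem isSpecialOssermanWith (hk : k ≠ 0)
    (hg : ∀ (p : M) (a b : V), g p a b = H.G k (chartAt V p p) a b)
    (hloc : ∀ e ∈ atlas V M, ∀ y ∈ e.target, ∀ a b, localMetric g e y a b = H.G k y a b)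
    (hN : ∀ e ∈ atlas V M, ∀ y ∈ e.target, H.N k y ≠ 0) :
    IsSpecialOssermanWith g (4 * k) k ∧ HasMultiplicity g (4 * k) 7 ∧ HasMultiplicity g k 8 := by
  have hev : ∀ e ∈ atlas V M, ∀ y ∈ e.target,
      ∀ᶠ z in nhds y, ∀ a b, localMetric g e z a b = H.G k z a b := fun e he y hy =>
    Filter.mem_of_superset (e.open_target.mem_nhds hy) (hloc e he)
  have hx : ∀ p : M, H.N k (chartAt V p p) ≠ 0 := fun p =>
    hN _ (chart_mem_atlas V p) _ (mem_chart_target V p)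
  have hJ : ∀ (p : M) (v : V), jacobi g p v = H.J k (chartAt V p p) v := fun p v =>
    H.jacobiLocal_metric k (hev _ (chart_mem_atlas V p) _ (mem_chart_target V p)) (hx p) v
  have hperp : ∀ (p : M) (v : V), perp g p v = LinearMap.ker (H.G k (chartAt V p p) v) := by
    intro p v
    refine Submodule.ext fun y => ?_
    exact Eq.congr_left (hg p v y)
  have hunit : ∀ (p : M) (v : V), IsUnitVector g p v → H.G k (chartAt V p p) v v ^ 2 = 1 := by
    intro p v hv
    rw [← hg]
    rcases hv with h | h
    · exact (congrArg (· ^ 2) h).trans (by norm_num)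
    · exact (congrArg (· ^ 2) h).trans (by norm_num)
  have hunit' : ∀ (p : M) (v : V), IsUnitVector g p v → H.G k (chartAt V p p) v v ≠ 0 := by
    intro p v hv h
    have := hunit p v hv
    norm_num [h] at this
  have heig : ∀ (c : ℝ) (p : M) (v : V), jacobiEigenspace g c p v =
      Module.End.eigenspace (H.J k (chartAt V p p) v) (H.G k (chartAt V p p) v v * c) := by
    intro c p v
    rw [← hJ, ← hg]
    rfl
  have hext : ∀ (p : M) (v : V), IsUnitVector g p v →
      extendedEigenspace g (4 * k) p v = LinearMap.range (H.K k (chartAt V p p) v) := by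
    intro p v hv
    have h := (heig (4 * k) p v).trans (H.eigenspace_J_four hk (hunit p v hv))
    exact (congrArg (fun L : Submodule ℝ V => Submodule.span ℝ {v} ⊔ L) h).trans
      (H.span_sup_range_K (hunit p v hv))
  refine ⟨⟨⟨?_, ?_, ?_⟩, mul_ne_zero four_ne_zero hk, hk, ?_, ?_, ?_, ?_⟩, ?_, ?_⟩
  · intro p v w
    exact (hg p v w).trans ((H.G_comm k _ v w).trans (hg p w v).symm)
  · intro p v h
    exact H.G_nondeg k _ (hx p) fun w => (hg p v w).symm.trans (h w)
  · intro e he y hy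
    exact (H.contDiffAt_metric k (hev e he y hy) (hN e he y hy)).contDiffWithinAt
  · intro h
    apply hk
    linarith
  · intro p v hv
    -- The restriction depends on the proof of invariance, so the operator, the subspace and the
    -- scalar are generalized before being replaced together.
    have key : ∀ (A : Module.End ℝ V) (L : Submodule ℝ V) (r : ℝ), A = H.J k (chartAt V p p) v →
        L = LinearMap.ker (H.G k (chartAt V p p) v) → r = H.G k (chartAt V p p) v v →
        ∃ h : ∀ y ∈ L, A y ∈ L, (⨆ c : ℝ, Module.End.eigenspace (A.restrict h) c) = ⊤ ∧
          ∀ c : ℝ, c ≠ 0 →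
            (Module.End.HasEigenvalue (A.restrict h) c ↔ c = r * (4 * k) ∨ c = r * k) := by
      rintro _ _ _ rfl rfl rfl
      exact H.J_restrict hk (hunit p v hv)
    exact key _ _ _ (hJ p v) (hperp p v) (hg p v v)
  · intro p v w hv hw h
    refine (hext p v hv).trans (Eq.trans ?_ (hext p w hw).symm)
    exact H.range_K_eq_of_mem (hunit p v hv) (hunit p w hw) ((hext p v hv).le h)
  · intro p v w hv h
    exact (heig k p w).ge (H.mem_eigenspace_J_symm hk (hunit' p v hv) ((heig k p v).le h))
  · intro p v hv
    have h₁ := (heig (4 * k) p v).trans (H.eigenspace_J_four hk (hunit p v hv))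
    have h₂ := (congrArg₂ (fun L L' : Submodule ℝ V => L ⊓ L') h₁ (hperp p v)).trans
      (inf_assoc _ _ _)
    rw [inf_idem] at h₂
    exact (congrArg (fun L : Submodule ℝ V => Module.finrank ℝ L) h₂).trans
      (H.finrank_range_K_inf (hunit p v hv))
  · intro p v hv
    have h₁ := (heig k p v).trans (H.eigenspace_J hk (hunit' p v hv))
    have h₂ := (congrArg₂ (fun L L' : Submodule ℝ V => L ⊓ L') h₁ (hperp p v)).trans
      (inf_of_le_left (H.ker_K_le (hunit' p v hv)))
    exact (congrArg (fun L : Submodule ℝ V => Module.finrank ℝ L) h₂).trans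
      (H.finrank_ker_K (hunit p v hv))

end LineTriple

/-! ### The metrics in coordinates -/

namespace CayleyAlgebra

variable {s : ℝ}

/-! ### The coordinate formula as the metric of the line triple -/

theorem re_mul (x y : CayleyAlgebra s) : re (x * y) = ip x (star y) := by
  rw [ip, star_star']

theorem N_pairTriple (hs : s ≠ 0) (k : ℝ) (x : CayleyAlgebra s × CayleyAlgebra s) :
    (pairTriple hs).N k x = 1 + k * normSq x.1 + k * normSq x.2 := by
  change 1 + k * (ip x.1 x.1 + ip x.2 x.2) = _
  simp only [normSq]
  ring

theorem fubiniStudyForm_eq (hs : s ≠ 0) (k : ℝ) (x a b : CayleyAlgebra s × CayleyAlgebra s) :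
    fubiniStudyForm k x a b = (pairTriple hs).G k x a b := by
  rw [LineTriple.G_eq, N_pairTriple, fubiniStudyForm_apply]
  congr 1
  have hT : (pairTriple hs).T x x a = (2 : ℝ) • lineOp x a := by
    rw [← LinearMap.smul_apply, ← pairOp_self]
    rfl
  have hB : ∀ y z, (pairTriple hs).B y z = ip y.1 z.1 + ip y.2 z.2 := fun _ _ => rfl
  have h₁ : re (x.1 * star x.2 * (a.2 * star b.1)) = ip (x.1 * star x.2 * a.2) b.1 := by
    rw [re_mul, star_mul', star_star', ← ip_mul_right]
  have h₂ : re (x.1 * star x.2 * (b.2 * star a.1)) = ip (x.2 * star x.1 * a.1) b.2 := by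
    rw [re_mul, ← ip_star_star, star_star', star_mul', star_star', ← ip_mul_right]
  rw [hT, hB, hB, h₁, h₂]
  simp only [Prod.smul_fst, Prod.smul_snd, ip_smul_left, lineOp_fst, lineOp_snd, ip_add_left]
  ring

/-! ### The transition maps preserve the metric -/

theorem fubiniStudyForm_comm (k : ℝ) (x a b : CayleyAlgebra s × CayleyAlgebra s) :
    fubiniStudyForm k x a b = fubiniStudyForm k x b a := by
  simp only [fubiniStudyForm_apply, ip_comm b.1, ip_comm b.2]
  ring

/-- `f` has a derivative at `x` that preserves the metric of the projective plane. -/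
def PreservesMetricAt (f : CayleyAlgebra s × CayleyAlgebra s → CayleyAlgebra s × CayleyAlgebra s)
    (x : CayleyAlgebra s × CayleyAlgebra s) : Prop :=
  DifferentiableAt ℝ f x ∧ ∀ a,
    fubiniStudyForm 1 (f x) (fderiv ℝ f x a) (fderiv ℝ f x a) = fubiniStudyForm 1 x a a

namespace PreservesMetricAt

variable {f h : CayleyAlgebra s × CayleyAlgebra s → CayleyAlgebra s × CayleyAlgebra s}
  {x : CayleyAlgebra s × CayleyAlgebra s}

theorem apply_apply (hf : PreservesMetricAt f x) (a b : CayleyAlgebra s × CayleyAlgebra s) :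
    fubiniStudyForm 1 (f x) (fderiv ℝ f x a) (fderiv ℝ f x b) = fubiniStudyForm 1 x a b := by
  have h₁ := hf.2 (a + b)
  have h₂ := hf.2 a
  have h₃ := hf.2 b
  simp only [map_add, add_apply] at h₁
  rw [fubiniStudyForm_comm 1 x b a, fubiniStudyForm_comm 1 (f x) (fderiv ℝ f x b)] at h₁
  linarith

theorem comp (hh : PreservesMetricAt h (f x)) (hf : PreservesMetricAt f x) :
    PreservesMetricAt (h ∘ f) x := by
  refine ⟨hh.1.comp x hf.1, fun a => ?_⟩
  rw [fderiv_comp x hh.1 hf.1]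
  exact (hh.2 _).trans (hf.2 a)

theorem id : PreservesMetricAt id x :=
  ⟨differentiableAt_id, fun a => by rw [fderiv_id]; rfl⟩

theorem swap : PreservesMetricAt Prod.swap x := by
  have e : (Prod.swap : CayleyAlgebra s × CayleyAlgebra s → _) =
    (ContinuousLinearEquiv.prodComm ℝ (CayleyAlgebra s) (CayleyAlgebra s)) := rfl
  rw [e]
  refine ⟨ContinuousLinearEquiv.differentiableAt _, fun a => ?_⟩
  rw [ContinuousLinearEquiv.fderiv]
  obtain ⟨u, v⟩ := x
  obtain ⟨b, c⟩ := a
  change fubiniStudyForm 1 (v, u) (c, b) (c, b) = _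
  have h : re (v * star u * (b * star c)) = re (u * star v * (c * star b)) := by
    rw [re_mul, re_mul, ← ip_star_star]
    simp only [star_mul', star_star']
  rw [fubiniStudyForm_self, fubiniStudyForm_self, h]
  ring

end PreservesMetricAt

/-- The transition map `(u, v) ↦ (u⁻¹, v u⁻¹)`. -/
def invMap (x : CayleyAlgebra s × CayleyAlgebra s) : CayleyAlgebra s × CayleyAlgebra s :=
  (x.1⁻¹, x.2 * x.1⁻¹)

/-- The derivative of `u ↦ u⁻¹`. -/
def invDeriv (u a : CayleyAlgebra s) : CayleyAlgebra s :=
  (normSq u)⁻¹ • star a - (2 * ip u a / normSq u ^ 2) • star u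

theorem hasDerivAt_inv {u : CayleyAlgebra s} (hu : normSq u ≠ 0) (a : CayleyAlgebra s) :
    HasDerivAt (fun t : ℝ => (u + t • a)⁻¹) (invDeriv u a) 0 := by
  -- Along a line `normSq` is a quadratic polynomial in `t`, so only the inverse of a scalar has to
  -- be differentiated.
  have e : (fun t : ℝ => (u + t • a)⁻¹) = fun t : ℝ =>
      (normSq u + t * (2 * ip u a) + t ^ 2 * normSq a)⁻¹ • (star u + t • star a) := by
    ext1 t
    rw [inv_def, normSq_add, ip_smul_right, normSq_smul, star_add', star_smul']
    congr 2
    ring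
  rw [e]
  have h₁ := (((hasDerivAt_id (0 : ℝ)).mul_const (2 * ip u a)).const_add (normSq u)).fun_add
    (((hasDerivAt_id (0 : ℝ)).fun_pow 2).mul_const (normSq a))
  have h₂ := ((hasDerivAt_id (0 : ℝ)).smul_const (star a)).const_add (star u)
  have h₃ := (h₁.fun_inv (by simpa using hu)).fun_smul h₂
  refine HasDerivAt.congr_deriv h₃ ?_
  simp only [id, invDeriv]
  module

theorem hasDerivAt_mul {f g : ℝ → CayleyAlgebra s} {f' g' : CayleyAlgebra s} {t : ℝ}
    (hf : HasDerivAt f f' t) (hg : HasDerivAt g g' t) :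
    HasDerivAt (fun r => f r * g r) (f t * g' + f' * g t) t :=
  ((LinearMap.mul ℝ (CayleyAlgebra s)).toContinuousBilinearMap.isBoundedBilinearMap.hasFDerivAt
    (f t, g t)).comp_hasDerivAt t (hf.prodMk hg)

theorem differentiableAt_invMap {x : CayleyAlgebra s × CayleyAlgebra s} (hx : normSq x.1 ≠ 0) :
    DifferentiableAt ℝ invMap x := by
  have h : ContDiffAt ℝ ∞ (fun y : CayleyAlgebra s × CayleyAlgebra s => y.1⁻¹) x :=
    ((contDiff_normSq.comp contDiff_fst).contDiffAt.inv hx).smul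
      (contDiff_star.comp contDiff_fst).contDiffAt
  have h' : ContDiffAt ℝ ∞ (invMap (s := s)) x :=
    h.prodMk (contDiff_mul.contDiffAt.comp x (contDiff_snd.contDiffAt.prodMk h))
  exact h'.differentiableAt (by simp)

theorem fderiv_invMap {x : CayleyAlgebra s × CayleyAlgebra s} (hx : normSq x.1 ≠ 0)
    (a : CayleyAlgebra s × CayleyAlgebra s) :
    fderiv ℝ invMap x a = (invDeriv x.1 a.1, a.2 * x.1⁻¹ + x.2 * invDeriv x.1 a.1) := by
  rw [← (differentiableAt_invMap hx).lineDeriv_eq_fderiv]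
  refine HasLineDerivAt.lineDeriv ?_
  have h₁ := hasDerivAt_inv hx a.1
  have h₂ : HasDerivAt (fun t : ℝ => x.2 + t • a.2) a.2 0 := by
    simpa using ((hasDerivAt_id (0 : ℝ)).smul_const a.2).const_add x.2
  have h₃ := h₁.prodMk (hasDerivAt_mul h₂ h₁)
  refine HasDerivAt.congr_deriv h₃ ?_
  rw [zero_smul, zero_smul, add_zero, add_zero, add_comm (x.2 * _)]

theorem normSq_invDeriv {u : CayleyAlgebra s} (hu : normSq u ≠ 0) (a : CayleyAlgebra s) :
    normSq (invDeriv u a) = normSq a / normSq u ^ 2 := by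
  rw [invDeriv, sub_eq_add_neg, ← neg_smul, normSq_add, normSq_smul, normSq_smul, ip_smul_left,
    ip_smul_right, ip_star_star, normSq_star, normSq_star, ip_comm a u]
  field_simp
  ring

/-- This is the cross term of `|b u⁻¹ + v δ|²`, where `δ` is the derivative of the inverse. `h₁`
plays the role of `δ = -u⁻¹ a u⁻¹`: polarized right alternativity gives `(v δ) u = -|u|⁻² (v ū) a`.
-/
theorem ip_invDeriv {u : CayleyAlgebra s} (hu : normSq u ≠ 0) (v a b : CayleyAlgebra s) :
    ip (b * u⁻¹) (v * invDeriv u a) = -re (u * star v * (b * star a)) / normSq u ^ 2 := by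
  have h₁ : v * invDeriv u a * u = -(normSq u)⁻¹ • (v * star u * a) := by
    have h := mul_mul_star_add (star u) (star a) v
    rw [star_star', star_star', ip_star_star] at h
    rw [invDeriv, mul_sub, sub_mul, mul_smul_comm, mul_smul_comm, smul_mul_assoc, smul_mul_assoc,
      mul_mul_star', smul_smul, div_mul_eq_mul_div]
    have e : 2 * ip u a * normSq u / normSq u ^ 2 = (normSq u)⁻¹ * (2 * ip u a) := by
      field_simp
    rw [e]
    linear_combination (norm := module) (normSq u)⁻¹ • h
  have h₂ : re (u * star v * (b * star a)) = ip b (v * star u * a) := by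
    rw [re_mul, ← ip_star_star]
    simp only [star_mul', star_star']
    rw [← ip_mul_right, ip_comm]
  rw [inv_def, mul_smul_comm, ip_smul_left, ip_mul_right, star_star', h₁, ip_smul_right, h₂]
  field_simp

theorem preservesMetricAt_invMap {x : CayleyAlgebra s × CayleyAlgebra s}
    (hx : 0 < normSq x.1) : PreservesMetricAt invMap x := by
  refine ⟨differentiableAt_invMap hx.ne', fun a => ?_⟩
  rw [fderiv_invMap hx.ne']
  obtain ⟨u, v⟩ := x
  obtain ⟨a, b⟩ := a
  simp only [invMap] at hx ⊢
  have hn : normSq u ≠ 0 := hx.ne'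
  have h₁ : u⁻¹ * star (v * u⁻¹) = (normSq u)⁻¹ • star v := by
    rw [star_mul', mul_star_mul, normSq_inv]
  have h₂ : re (u⁻¹ * star (v * u⁻¹) * ((b * u⁻¹ + v * invDeriv u a) * star (invDeriv u a))) =
      (normSq u)⁻¹ * (ip (b * u⁻¹) (v * invDeriv u a) + normSq v * normSq (invDeriv u a)) := by
    rw [h₁, smul_mul_assoc, re_smul, re_mul, ip_star_star, ← ip_mul_right, ip_comm, ip_add_left,
      ← normSq_mul]
    rfl
  rw [fubiniStudyForm_self, fubiniStudyForm_self, h₂, normSq_add, normSq_mul, normSq_mul,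
    normSq_mul, normSq_inv, ip_invDeriv hn, normSq_invDeriv hn]
  have hN : 1 + (normSq u)⁻¹ + normSq v * (normSq u)⁻¹ =
      (1 + normSq u + normSq v) / normSq u := by
    field_simp
    ring
  rw [hN, div_pow, div_div_eq_mul_div]
  congr 1
  field_simp
  ring

theorem preservesMetricAt_transition (i j : Fin 3) {x : CayleyAlgebra s × CayleyAlgebra s}
    (h : 0 < normSq (triple i x j)) : PreservesMetricAt (transition i j) x := by
  have e : ∀ i : Fin 3, (transition i i : CayleyAlgebra s × CayleyAlgebra s → _) = id := by
    intro i
    ext1 y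
    simp only [transition, triple_self, inv_one', mul_one]
    exact affinePart_triple i y
  have e₁ : (transition 0 1 : CayleyAlgebra s × CayleyAlgebra s → _) = invMap :=
    funext fun y => Prod.ext (one_mul _) rfl
  have e₂ : (transition 0 2 : CayleyAlgebra s × CayleyAlgebra s → _) = invMap ∘ Prod.swap :=
    funext fun y => Prod.ext (one_mul _) rfl
  have e₃ : (transition 1 0 : CayleyAlgebra s × CayleyAlgebra s → _) = invMap :=
    funext fun y => Prod.ext (one_mul _) rfl
  have e₄ : (transition 1 2 : CayleyAlgebra s × CayleyAlgebra s → _) =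
    Prod.swap ∘ invMap ∘ Prod.swap := funext fun y => Prod.ext rfl (one_mul _)
  have e₅ : (transition 2 0 : CayleyAlgebra s × CayleyAlgebra s → _) = Prod.swap ∘ invMap :=
    funext fun y => Prod.ext rfl (one_mul _)
  have e₆ : (transition 2 1 : CayleyAlgebra s × CayleyAlgebra s → _) =
    Prod.swap ∘ invMap ∘ Prod.swap := funext fun y => Prod.ext rfl (one_mul _)
  have c₁ : 0 < normSq x.1 → PreservesMetricAt invMap x := preservesMetricAt_invMap
  have c₂ : 0 < normSq x.2 → PreservesMetricAt (invMap ∘ Prod.swap) x := fun h =>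
    (preservesMetricAt_invMap (x := x.swap) h).comp .swap
  fin_cases i <;> fin_cases j
  · exact e 0 ▸ .id
  · exact e₁ ▸ c₁ h
  · exact e₂ ▸ c₂ h
  · exact e₃ ▸ c₁ h
  · exact e 1 ▸ .id
  · exact e₄ ▸ PreservesMetricAt.swap.comp (c₂ h)
  · exact e₅ ▸ PreservesMetricAt.swap.comp (c₁ h)
  · exact e₆ ▸ PreservesMetricAt.swap.comp (c₂ h)
  · exact e 2 ▸ .id

end CayleyAlgebra

section LocalMetric

variable {E : Type*} [NormedAddCommGroup E] [NormedSpace ℝ E] {M : Type*} [TopologicalSpace M]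
  [ChartedSpace E M] [IsManifold 𝓘(ℝ, E) 1 M]

/-- The tangent space at `e.symm x` is identified with `E` by the preferred chart there, so the
differential of `e.symm` is that of the transition map `f` to this chart. -/
theorem localMetric_apply
    (g : ∀ p : M, TangentSpace 𝓘(ℝ, E) p →L[ℝ] TangentSpace 𝓘(ℝ, E) p →L[ℝ] ℝ)
    {e : OpenPartialHomeomorph M E} (he : e ∈ atlas E M) {x : E} (hx : x ∈ e.target)
    {f : E → E} (hf : (fun y => chartAt E (e.symm x) (e.symm y)) =ᶠ[nhds x] f) (a b : E) :
    localMetric g e x a b = g (e.symm x) (fderiv ℝ f x a) (fderiv ℝ f x b) := by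
  have h : MDifferentiableAt 𝓘(ℝ, E) 𝓘(ℝ, E) e.symm x := mdifferentiableAt_atlas_symm he hx
  have h' : (mfderiv 𝓘(ℝ, E) 𝓘(ℝ, E) e.symm x : E →L[ℝ] E) = fderiv ℝ f x := by
    rw [← hf.fderiv_eq]
    refine h.mfderiv.trans ?_
    rw [modelWithCornersSelf_coe, Set.range_id, fderivWithin_univ]
    rfl
  rw [← h']
  rfl

end LocalMetric

/-! ### The projective planes and the hyperbolic plane -/

theorem exists_chartAt_eq_planeHomeo {s : ℝ} (p : Plane s) :
    ∃ j, chartAt (CayleyAlgebra s × CayleyAlgebra s) p = planeHomeo s j :=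
  (mem_atlas_plane_iff _).1 (chart_mem_atlas _ p)

/-- The metric of the projective plane has the same expression in the three charts. -/
theorem localMetric_planeMetric {s : ℝ} (i : Fin 3) {x : CayleyAlgebra s × CayleyAlgebra s}
    (hx : x ∈ coordDomain s) :
    localMetric (planeMetric s) (planeHomeo s i) x = fubiniStudyForm 1 x := by
  obtain ⟨j, hj⟩ := exists_chartAt_eq_planeHomeo ((planeHomeo s i).symm x)
  have hmem : x ∈ coordDomain s ∩ {x | 0 < normSq (triple i x j)} := by
    rw [← planeChart_trans_source]
    refine ⟨hx, ?_⟩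
    have := mem_chart_source (CayleyAlgebra s × CayleyAlgebra s) ((planeHomeo s i).symm x)
    rw [hj] at this
    exact this
  have heq : ∀ y ∈ coordDomain s ∩ {x | 0 < normSq (triple i x j)},
      chartAt (CayleyAlgebra s × CayleyAlgebra s) ((planeHomeo s i).symm x)
        ((planeHomeo s i).symm y) = transition i j y := by
    intro y hy
    rw [hj]
    exact planeChart_trans_eqOn s i j hy
  refine ContinuousLinearMap.ext fun a => ContinuousLinearMap.ext fun b => ?_
  rw [localMetric_apply _ ((mem_atlas_plane_iff _).2 ⟨i, rfl⟩) hx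
    (f := transition i j) (Filter.mem_of_superset ((isOpen_transition_source s i j).mem_nhds hmem)
      heq)]
  rw [planeMetric, heq x hmem]
  exact (preservesMetricAt_transition i j hmem.2).apply_apply a b

theorem plane_isSpecialOsserman {s : ℝ} (hs : s ≠ 0) :
    IsSpecialOssermanWith (M := Plane s) (planeMetric s) 4 1 ∧
      HasMultiplicity (M := Plane s) (planeMetric s) 4 7 ∧
      HasMultiplicity (M := Plane s) (planeMetric s) 1 8 := by
  have h := (pairTriple hs).isSpecialOssermanWith (M := Plane s) (g := planeMetric s) one_ne_zero
    (fun p a b => fubiniStudyForm_eq hs 1 _ a b)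
    (fun e he y hy a b => by
      obtain ⟨i, rfl⟩ := (mem_atlas_plane_iff e).1 he
      rw [localMetric_planeMetric i hy, fubiniStudyForm_eq hs])
    (fun e he y hy => by
      obtain ⟨i, rfl⟩ := (mem_atlas_plane_iff e).1 he
      have hy' : 0 < 1 + normSq y.1 + normSq y.2 := hy
      rw [N_pairTriple, one_mul, one_mul]
      exact hy'.ne')
  rwa [mul_one] at h

theorem localMetric_hyperbolicMetric
    {e : OpenPartialHomeomorph HyperbolicPlane (Octonion × Octonion)}
    (he : e ∈ atlas (Octonion × Octonion) HyperbolicPlane) {y : Octonion × Octonion}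
    (hy : y ∈ e.target) :
    y ∈ HyperbolicPlane ∧ localMetric hyperbolicMetric e y = fubiniStudyForm (-1) y := by
  -- Every chart in the atlas of an open subset of the model space is a restriction of the identity.
  have hcoe : ∀ p : HyperbolicPlane, e p = p.1 := by
    obtain ⟨q, hq⟩ := Set.mem_iUnion.1 he
    rw [Set.mem_singleton_iff.1 hq]
    intro p
    rfl
  have hval : ∀ z ∈ e.target, (e.symm z).1 = z := fun z hz => by
    rw [← hcoe, e.right_inv hz]
  refine ⟨hval y hy ▸ (e.symm y).2, ?_⟩
  refine ContinuousLinearMap.ext fun a => ContinuousLinearMap.ext fun b => ?_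
  rw [localMetric_apply _ he hy (f := id)
    (Filter.mem_of_superset (e.open_target.mem_nhds hy) hval), fderiv_id]
  rw [hyperbolicMetric, hval y hy]
  rfl

theorem hyperbolicPlane_isSpecialOsserman :
    IsSpecialOssermanWith (M := HyperbolicPlane) hyperbolicMetric (-4) (-1) ∧
      HasMultiplicity (M := HyperbolicPlane) hyperbolicMetric (-4) 7 ∧
      HasMultiplicity (M := HyperbolicPlane) hyperbolicMetric (-1) 8 := by
  have hs : (-1 : ℝ) ≠ 0 := by norm_num
  have h := (pairTriple hs).isSpecialOssermanWith (M := HyperbolicPlane) (g := hyperbolicMetric) hs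
    (fun p a b => fubiniStudyForm_eq hs (-1) _ a b)
    (fun e he y hy a b => by
      rw [(localMetric_hyperbolicMetric he hy).2, fubiniStudyForm_eq hs])
    (fun e he y hy => by
      have hy' : normSq y.1 + normSq y.2 < 1 := (localMetric_hyperbolicMetric he hy).1
      rw [N_pairTriple]
      linarith)
  rwa [mul_neg_one] at h

end

theorem mainTheorem3 :
    -- the octonionic projective plane
    ((∀ i, ∀ x ∈ coordDomain (-1),
        localMetric (planeMetric (-1)) (planeHomeo (-1) i) x = fubiniStudyForm 1 x) ∧
      IsSpecialOssermanWith (M := OctonionicPlane) (planeMetric (-1)) 4 1 ∧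
      HasMultiplicity (M := OctonionicPlane) (planeMetric (-1)) 4 7 ∧
      HasMultiplicity (M := OctonionicPlane) (planeMetric (-1)) 1 8) ∧
    -- the para-octonionic projective plane
    ((∀ i, ∀ x ∈ coordDomain 1,
        localMetric (planeMetric 1) (planeHomeo 1 i) x = fubiniStudyForm 1 x) ∧
      IsSpecialOssermanWith (M := ParaOctonionicPlane) (planeMetric 1) 4 1 ∧
      HasMultiplicity (M := ParaOctonionicPlane) (planeMetric 1) 4 7 ∧
      HasMultiplicity (M := ParaOctonionicPlane) (planeMetric 1) 1 8) ∧
    -- the octonionic hyperbolic plane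
    (IsSpecialOssermanWith (M := HyperbolicPlane) hyperbolicMetric (-4) (-1) ∧
      HasMultiplicity (M := HyperbolicPlane) hyperbolicMetric (-4) 7 ∧
      HasMultiplicity (M := HyperbolicPlane) hyperbolicMetric (-1) 8) := by
  have h : (-1 : ℝ) ≠ 0 := by norm_num
  exact ⟨⟨fun i _ hx => localMetric_planeMetric i hx, plane_isSpecialOsserman h⟩,
    ⟨fun i _ hx => localMetric_planeMetric i hx, plane_isSpecialOsserman one_ne_zero⟩,
    hyperbolicPlane_isSpecialOsserman⟩
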